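/- For $n\ge 0$ let $Q_n$ be the $n$-dimensional hypercube graph, with vertex set $\{0,1\}^n$, two vertices being adjacent if and only if they differ in exactly one coordinate. Let $H$ be a non-empty graph (i.e. with at least one vertex) that is isomorphic to an induced subgraph of $Q_k$ for some $k$. Then there are constants $c = c(H)$ and $C = C(H)$, non-negative integers depending only on $H$, such that for every $n \ge 1$ there is a collection of pairwise disjoint subsets of $V(Q_n)$, each of which induces in $Q_n$ a subgraph isomorphic to $H$, such that at most $C n^c$ vertices of $Q_n$ belong to none of these subsets. -/

import Mathlib

/-- The hypercube `Q_n`: its vertices are the `0`-`1` sequences of length `n`, and two of them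
are adjacent iff they differ in exactly one coordinate. -/
def hypercube (n : ℕ) : SimpleGraph (Fin n → Bool) where
  Adj x y := hammingDist x y = 1
  symm := ⟨fun x y h => by rwa [hammingDist_comm]⟩
  loopless := ⟨fun x h => by simp at h⟩

/-- A packing of `G` by induced copies of `H`: a collection of pairwise disjoint vertex sets of
`G`, each of which induces in `G` a graph isomorphic to `H`. -/
structure IsInducedPacking {V W : Type*} (H : SimpleGraph V) (G : SimpleGraph W)
    (P : Set (Set W)) : Prop where
  induced : ∀ S ∈ P, Nonempty (H ≃g G.induce S)
  disjoint : P.PairwiseDisjoint id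

open Set Function
open scoped Pointwise

/-! Realise the graph as a set H of m points of F_2^k containing 0, and tile with translates of H
along k distinct coordinate directions (`cubeTiles`).

The engine is `Flexible`: a cube Q' with disjoint sets W_i such that, once any J of them with |J| ≡
ρ mod m is deleted, the rest can be tiled. Suppose that copies of H in a cube Q are split into
families of disjoint copies, each family owning one W_i, and that a point of Q lies in ρ families
modulo m. In Q × Q', use the i-th family in the rows over W_i; what remains of the column over that
point is the complement of ρ (mod m) of the W_i, hence tileable (`exists_tileable_superset`). A
signed sum over copies (`single_mem_tileSpan`) provides such families for all points of Q except
those with fewer than k ones outside k spare coordinates. There are polynomially many families, and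
`exists_flexible_two_pow` serves them with dim Q' = O(log n). So the exceptional points times Q' are
polynomially many.

Flexible sets are built with affine images of H as tiles (`affTiles`), since the linear map F_2^Y →
Y sending e_y to y pulls such tilings back to coordinate tilings
(`tileable_preimage_linearCombination`). With spare dimensions, parallel flats can be switched, so m
of them can be absorbed (`switchable_lowFree`, `exists_absorber_of_flats`). A colouring makes room
for many absorbers at once and yields `tileable_compl_holes`. Finally `Flexible.prod` doubles the
number of sets at the price of boundedly many dimensions. -/

/-- `X` is a disjoint union of sets that belong to `𝒯`. -/
def Tileable {Y : Type*} (𝒯 : Set (Set Y)) (X : Set Y) : Prop :=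
  ∃ P ⊆ 𝒯, P.PairwiseDisjoint id ∧ ⋃₀ P = X

/-! ### Disjoint unions of tiles. -/

namespace Tileable

variable {Y Z : Type*} {𝒯 : Set (Set Y)} {𝒯' : Set (Set Z)}

theorem empty : Tileable 𝒯 (∅ : Set Y) :=
  ⟨∅, by simp, by simp, by simp⟩

theorem of_mem {T : Set Y} (hT : T ∈ 𝒯) : Tileable 𝒯 T :=
  ⟨{T}, by simpa, by simp, by simp⟩

theorem iUnion {ι : Type*} {X : ι → Set Y} (hd : Pairwise (Disjoint on X))
    (hX : ∀ i, Tileable 𝒯 (X i)) : Tileable 𝒯 (⋃ i, X i) := by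
  choose P hP hPd hPX using hX
  refine ⟨⋃ i, P i, iUnion_subset hP, ?_, ?_⟩
  · intro A hA B hB hAB
    obtain ⟨i, hi⟩ := mem_iUnion.1 hA
    obtain ⟨j, hj⟩ := mem_iUnion.1 hB
    by_cases hij : i = j
    · subst hij
      exact hPd i hi hj hAB
    · have hAi : A ⊆ X i := by rw [← hPX i]; exact subset_sUnion_of_mem hi
      have hBj : B ⊆ X j := by rw [← hPX j]; exact subset_sUnion_of_mem hj
      exact (hd hij).mono hAi hBj
  · rw [sUnion_iUnion]
    exact iUnion_congr hPX

theorem biUnion {ι : Type*} {s : Set ι} {X : ι → Set Y} (hd : s.PairwiseDisjoint X)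
    (hX : ∀ i ∈ s, Tileable 𝒯 (X i)) : Tileable 𝒯 (⋃ i ∈ s, X i) := by
  rw [biUnion_eq_iUnion]
  refine iUnion ?_ fun i => hX i i.2
  intro i j hij
  exact hd i.2 j.2 fun h => hij (Subtype.ext h)

theorem union {A B : Set Y} (hd : Disjoint A B) (hA : Tileable 𝒯 A) (hB : Tileable 𝒯 B) :
    Tileable 𝒯 (A ∪ B) := by
  rw [union_eq_iUnion]
  refine iUnion ?_ (by rintro (_ | _) <;> assumption)
  rintro (_ | _) (_ | _) h
  · exact absurd rfl h
  · exact hd.symm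
  · exact hd
  · exact absurd rfl h

/-- A set is tileable if it is the disjoint union of the fibres of a map, each of them
tileable. -/
theorem of_fibers {ι : Type*} {X : Set Y} (p : Y → ι)
    (hX : ∀ i, Tileable 𝒯 (X ∩ p ⁻¹' {i})) : Tileable 𝒯 X := by
  have : X = ⋃ i, X ∩ p ⁻¹' {i} := by ext; simp
  rw [this]
  refine iUnion ?_ hX
  intro i j hij
  rw [onFun, Set.disjoint_left]
  rintro x ⟨_, hx⟩ ⟨_, hx'⟩
  exact hij (hx.symm.trans hx')

theorem image {f : Y → Z} (hf : Injective f) (hT : ∀ T ∈ 𝒯, f '' T ∈ 𝒯') {X : Set Y}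
    (hX : Tileable 𝒯 X) : Tileable 𝒯' (f '' X) := by
  obtain ⟨P, hP, hd, rfl⟩ := hX
  refine ⟨Set.image f '' P, ?_, ?_, ?_⟩
  · rintro _ ⟨T, hTP, rfl⟩
    exact hT T (hP hTP)
  · rintro _ ⟨A, hA, rfl⟩ _ ⟨B, hB, rfl⟩ hAB
    exact (disjoint_image_iff hf).2 (hd hA hB fun h => hAB (h ▸ rfl))
  · rw [image_sUnion]

theorem preimage {f : Z → Y} (hT : ∀ T ∈ 𝒯, Tileable 𝒯' (f ⁻¹' T)) {X : Set Y}
    (hX : Tileable 𝒯 X) : Tileable 𝒯' (f ⁻¹' X) := by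
  obtain ⟨P, hP, hd, rfl⟩ := hX
  rw [preimage_sUnion]
  exact biUnion (fun A hA B hB h => (hd hA hB h).preimage f) fun T h => hT T (hP h)

end Tileable

/-! ### Coordinate copies and affine copies of H. -/

section Tiles

variable {k : ℕ} (H : Finset (Fin k → ZMod 2))

/-- The copies of `H` in the cube `ι → ZMod 2`. -/
def cubeTiles (ι : Type*) : Set (Set (ι → ZMod 2)) :=
  {T | ∃ (f : Fin k ↪ ι) (b : ι → ZMod 2), T = image (fun h => b + extend f h 0) H}

/-- The images of `H` under injective affine maps into a vector space over `ZMod 2`. -/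
def affTiles (Y : Type*) [AddCommGroup Y] [Module (ZMod 2) Y] : Set (Set Y) :=
  {T | ∃ (φ : (Fin k → ZMod 2) →ₗ[ZMod 2] Y) (u : Y), Injective φ ∧ T = (fun h => u + φ h) '' H}

variable {H} {Y Z : Type*} [AddCommGroup Y] [Module (ZMod 2) Y] [AddCommGroup Z]
  [Module (ZMod 2) Z]

theorem Tileable.affine_image {X : Set Y} (hX : Tileable (affTiles H Y) X) (φ : Y →ₗ[ZMod 2] Z)
    (hφ : Injective φ) (u : Z) : Tileable (affTiles H Z) ((fun y => u + φ y) '' X) := by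
  refine hX.image (fun a b h => hφ (add_left_cancel h)) ?_
  rintro _ ⟨ψ, v, hψ, rfl⟩
  refine ⟨φ ∘ₗ ψ, u + φ v, hφ.comp hψ, ?_⟩
  rw [image_image]
  simp [add_assoc]

end Tiles

/-! ### Switching two parallel flats. -/

section Switch

open Module

variable {k : ℕ} {H : Finset (Fin k → ZMod 2)} {E : Type*} [AddCommGroup E] [Module (ZMod 2) E]

theorem add_self_of_zmod_two (x : E) : x + x = 0 := by
  rw [← two_smul (ZMod 2) x, show (2 : ZMod 2) = 0 from rfl, zero_smul]

theorem zmod_two_eq_one_of_ne_zero {a : ZMod 2} (h : a ≠ 0) : a = 1 := by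
  revert h; revert a; decide

/-- The vectors that belong to `H` once their first `j` coordinates are replaced by `0`. -/
def lowFree (H : Finset (Fin k → ZMod 2)) (j : ℕ) : Set (Fin k → ZMod 2) :=
  {x | (fun i : Fin k => if (i : ℕ) < j then 0 else x i) ∈ H}

theorem lowFree_zero : lowFree H 0 = H := by
  ext x; simp [lowFree]

theorem lowFree_top (h0 : 0 ∈ H) : lowFree H k = univ := by
  ext x
  simp only [lowFree, Fin.is_lt, if_true, mem_ofPred_eq, mem_univ, iff_true]
  exact h0

theorem mem_lowFree_succ {j : ℕ} (hj : j < k) (x : Fin k → ZMod 2) :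
    x ∈ lowFree H (j + 1) ↔ update x ⟨j, hj⟩ 0 ∈ lowFree H j := by
  simp only [lowFree, mem_ofPred_eq]
  have : (fun i : Fin k => if (i : ℕ) < j + 1 then 0 else x i) =
      fun i : Fin k => if (i : ℕ) < j then 0 else update x ⟨j, hj⟩ 0 i := by
    funext i
    by_cases hi : i = ⟨j, hj⟩
    · subst hi; simp
    · have : (i : ℕ) ≠ j := fun h => hi (Fin.ext h)
      have h2 : (i : ℕ) < j + 1 ↔ (i : ℕ) < j := by omega
      simp [hi, h2]
  rw [this]

local notation "lc" => Fintype.linearCombination (ZMod 2)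

theorem linearCombination_update (w : Fin k → E) (j : Fin k) (c : E) (x : Fin k → ZMod 2) :
    lc (update w j c) x = x j • c + lc w (update x j 0) := by
  simp only [Fintype.linearCombination_apply]
  rw [← Finset.add_sum_erase _ _ (Finset.mem_univ j),
    ← Finset.add_sum_erase Finset.univ (fun i => update x j 0 i • w i) (Finset.mem_univ j)]
  simp only [update_self, zero_smul, zero_add]
  congr 1
  refine Finset.sum_congr rfl fun i hi => ?_
  simp [Finset.ne_of_mem_erase hi]

theorem linearCombination_mem {F : Submodule (ZMod 2) E} {w : Fin k → E} (hw : ∀ i, w i ∈ F)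
    (x : Fin k → ZMod 2) : lc w x ∈ F := by
  rw [Fintype.linearCombination_apply]
  exact F.sum_mem fun i _ => F.smul_mem _ (hw i)

theorem linearIndependent_update {F : Submodule (ZMod 2) E} {w : Fin k → E} (hw : ∀ i, w i ∈ F)
    (hi : Injective (lc w)) {j : Fin k} {c : E} (hc : c ∉ F) :
    Injective (lc (update w j c)) := by
  rw [← LinearMap.ker_eq_bot, LinearMap.ker_eq_bot']
  intro x hx
  rw [linearCombination_update] at hx
  have hxj : x j = 0 := by
    by_contra h
    rw [zmod_two_eq_one_of_ne_zero h, one_smul] at hx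
    apply hc
    rw [eq_neg_of_add_eq_zero_left hx]
    exact F.neg_mem (linearCombination_mem hw _)
  rw [hxj, zero_smul, zero_add] at hx
  have := hi (hx.trans (map_zero _).symm)
  rw [← hxj, update_eq_self] at this
  exact this

theorem not_mem_range_update {F : Submodule (ZMod 2) E} {w : Fin k → E} (hw : ∀ i, w i ∈ F)
    {a : E} (haF : a ∈ F) (ha : a ∉ range (lc w)) {j : Fin k} {c : E} (hc : c ∉ F) :
    a ∉ range (lc (update w j c)) := by
  rintro ⟨x, hx⟩
  rw [linearCombination_update] at hx
  by_cases h : x j = 0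
  · rw [h, zero_smul, zero_add] at hx
    exact ha ⟨_, hx⟩
  · rw [zmod_two_eq_one_of_ne_zero h, one_smul] at hx
    apply hc
    rw [eq_sub_of_add_eq hx]
    exact F.sub_mem haF (linearCombination_mem hw _)

/-- Slicing by the `j`-th coordinate gives a part independent of `c` and a part that `c` merely
translates. So `c` can be chosen to send the second part to any desired place. -/
theorem image_lowFree_update (w : Fin k → E) (j : Fin k) (c : E) :
    lc (update w j c) '' lowFree H j =
      lc w '' {x | x j = 0 ∧ x ∈ lowFree H j} ∪
        (c +ᵥ lc w '' {x | x j = 0 ∧ update x j 1 ∈ lowFree H j}) := by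
  ext y
  simp only [mem_image, mem_union, mem_vadd_set, mem_ofPred_eq, vadd_eq_add]
  constructor
  · rintro ⟨x, hx, rfl⟩
    rw [linearCombination_update]
    by_cases h : x j = 0
    · left
      refine ⟨x, ⟨h, hx⟩, ?_⟩
      rw [h, zero_smul, zero_add, ← h, update_eq_self]
    · right
      have h1 := zmod_two_eq_one_of_ne_zero h
      refine ⟨_, ⟨update x j 0, ⟨by simp, ?_⟩, rfl⟩, by rw [h1, one_smul]⟩
      rwa [update_idem, ← h1, update_eq_self]
  · rintro (⟨x, ⟨h, hx⟩, rfl⟩ | ⟨_, ⟨x, ⟨h, hx⟩, rfl⟩, rfl⟩)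
    · refine ⟨x, hx, ?_⟩
      rw [linearCombination_update, h, zero_smul, zero_add, ← h, update_eq_self]
    · refine ⟨_, hx, ?_⟩
      rw [linearCombination_update, update_self, one_smul, update_idem, ← h, update_eq_self]

theorem image_lowFree_succ (w : Fin k → E) (j : Fin k) :
    lc w '' lowFree H (j + 1) =
      lc w '' {x | x j = 0 ∧ x ∈ lowFree H j} ∪
        (w j +ᵥ lc w '' {x | x j = 0 ∧ x ∈ lowFree H j}) := by
  have key : ∀ x : Fin k → ZMod 2, lc w x = x j • w j + lc w (update x j 0) := fun x => by
    have := linearCombination_update w j (w j) x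
    rwa [update_eq_self] at this
  ext y
  simp only [mem_image, mem_union, mem_vadd_set, mem_ofPred_eq, vadd_eq_add]
  constructor
  · rintro ⟨x, hx, rfl⟩
    rw [mem_lowFree_succ j.2] at hx
    by_cases h : x j = 0
    · left
      rw [← h, update_eq_self] at hx
      exact ⟨x, ⟨h, hx⟩, rfl⟩
    · right
      have h1 := zmod_two_eq_one_of_ne_zero h
      exact ⟨_, ⟨_, ⟨by simp, hx⟩, rfl⟩, by rw [key x, h1, one_smul]⟩
  · rintro (⟨x, ⟨h, hx⟩, rfl⟩ | ⟨_, ⟨x, ⟨h, hx⟩, rfl⟩, rfl⟩)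
    · refine ⟨x, ?_, rfl⟩
      rw [mem_lowFree_succ j.2]
      change update x j 0 ∈ _
      rwa [← h, update_eq_self]
    · refine ⟨update x j 1, ?_, ?_⟩
      · rw [mem_lowFree_succ j.2]
        change update _ j 0 ∈ _
        rwa [update_idem, ← h, update_eq_self]
      · rw [key, update_self, one_smul, update_idem, ← h, update_eq_self]

/-- `A` and `B` can be exchanged with each other by retiling a set `R` that lies outside `F` and
enlarges the dimension by at most `r`. -/
def Switchable (H : Finset (Fin k → ZMod 2)) (r : ℕ) (F : Submodule (ZMod 2) E) (A B : Set E) :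
    Prop :=
  ∃ (R : Set E) (F' : Submodule (ZMod 2) E), F ≤ F' ∧ finrank (ZMod 2) F' ≤ finrank (ZMod 2) F + r ∧
    R ⊆ F' ∧ Disjoint R F ∧ Tileable (affTiles H E) (R ∪ A) ∧ Tileable (affTiles H E) (R ∪ B)

theorem vadd_subset_of_mem {F : Submodule (ZMod 2) E} {u : E} (hu : u ∈ F) {Z : Set E}
    (hZ : Z ⊆ F) : u +ᵥ Z ⊆ F := by
  rintro _ ⟨z, hz, rfl⟩
  exact F.add_mem hu (hZ hz)

theorem vadd_disjoint_of_not_mem {F : Submodule (ZMod 2) E} {u : E} (hu : u ∉ F) {Z : Set E}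
    (hZ : Z ⊆ F) : Disjoint (u +ᵥ Z) (F : Set E) := by
  rw [Set.disjoint_left]
  rintro _ ⟨z, hz, rfl⟩ h
  exact hu ((F.add_mem_iff_left (hZ hz)).1 h)

theorem Tileable.union_regroup {Y : Type*} {𝒯 : Set (Set Y)} {R R' A A' C C' : Set Y}
    (h : Tileable 𝒯 (R ∪ (A ∪ C))) (h' : Tileable 𝒯 (R' ∪ (A' ∪ C')))
    (hR : Disjoint R R' ∧ Disjoint R A' ∧ Disjoint R C')
    (hA : Disjoint A R' ∧ Disjoint A A' ∧ Disjoint A C')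
    (hC : Disjoint C R' ∧ Disjoint C A' ∧ Disjoint C C') :
    Tileable 𝒯 (R ∪ R' ∪ C ∪ C' ∪ (A ∪ A')) := by
  have hd : Disjoint (R ∪ (A ∪ C)) (R' ∪ (A' ∪ C')) := by
    simp only [disjoint_union_left, disjoint_union_right]
    tauto
  convert h.union hd h' using 1
  ext y
  simp only [mem_union]
  tauto

/-- Freeing coordinate `j` turns the set into two translates of Z₀, by 0 and `w j`. Each is
completed by a translate of Z₁ to a set freed only below `j`, with `w j` replaced by a vector
outside `F`, and the induction hypothesis moves it by `a`. The vectors are chosen so that the two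
moves exchange the two translates of Z₁, which can therefore be put into the auxiliary set. -/
theorem switchable_lowFree [FiniteDimensional (ZMod 2) E] (j : ℕ) (hj : j ≤ k) :
    ∀ (F : Submodule (ZMod 2) E) (w : Fin k → E) (a u : E), (∀ i, w i ∈ F) → a ∈ F → u ∈ F →
      Injective (lc w) → a ∉ range (lc w) →
      finrank (ZMod 2) F + (2 ^ j - 1) ≤ finrank (ZMod 2) E →
      Switchable H (2 ^ j - 1) F (u +ᵥ lc w '' lowFree H j) ((u + a) +ᵥ lc w '' lowFree H j) := by
  induction j with
  | zero =>
    intro F w a u hw ha hu hi har hF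
    have tile : ∀ v : E, Tileable (affTiles H E) (∅ ∪ (v +ᵥ lc w '' lowFree H 0)) := by
      intro v
      rw [empty_union, lowFree_zero]
      refine Tileable.of_mem ⟨lc w, v, hi, ?_⟩
      ext y
      simp [mem_vadd_set]
    exact ⟨∅, F, le_rfl, by simp, by simp, by simp, tile _, tile _⟩
  | succ j ih =>
    intro F w a u hw ha hu hi har hF
    have hjk : j < k := hj
    set jj : Fin k := ⟨j, hjk⟩ with hjj
    -- One dimension for `c`, and the rest for the two uses of the induction hypothesis.
    have h2 : 2 ^ (j + 1) - 1 = 1 + (2 ^ j - 1) + (2 ^ j - 1) := by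
      have : 1 ≤ 2 ^ j := Nat.one_le_two_pow
      rw [pow_succ]; omega
    rw [h2] at hF ⊢
    have hFlt : F < ⊤ := by
      rw [lt_top_iff_ne_top]
      rintro rfl
      rw [finrank_top] at hF
      omega
    obtain ⟨c, -, hc⟩ := SetLike.exists_of_lt hFlt
    set F₁ := F ⊔ Submodule.span (ZMod 2) {c} with hF₁
    have hcF₁ : c ∈ F₁ := Submodule.mem_sup_right (Submodule.mem_span_singleton_self c)
    have hFF₁ : F ≤ F₁ := le_sup_left
    have hdim₁ : finrank (ZMod 2) F₁ ≤ finrank (ZMod 2) F + 1 := by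
      refine (Submodule.finrank_add_le_finrank_add_finrank _ _).trans ?_
      gcongr
      exact (finrank_span_singleton (fun h : c = 0 => hc (h ▸ F.zero_mem))).le
    -- In characteristic 2 this makes the second move start with Z₁ at `u + a + c` and end with it
    -- at `u + c`, the reverse of the first move.
    set d : E := w jj + a + c with hd
    have hdF : d ∉ F := fun h => hc ((F.add_mem_iff_right (F.add_mem (hw jj) ha)).1 h)
    have hdF₁ : d ∈ F₁ := F₁.add_mem (hFF₁ (F.add_mem (hw jj) ha)) hcF₁
    have hupd : ∀ v ∈ F₁, ∀ i, update w jj v i ∈ F₁ := by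
      intro v hv i
      by_cases h : i = jj
      · subst h; simpa
      · simpa [h] using hFF₁ (hw i)
    obtain ⟨R, F₂, hF₁₂, hdim₂, hRF, hRd, ht₁, ht₁'⟩ := ih (by omega) F₁ (update w jj c) a u
      (hupd c hcF₁) (hFF₁ ha) (hFF₁ hu) (linearIndependent_update hw hi hc)
      (not_mem_range_update hw ha har hc) (by omega)
    obtain ⟨R', F₃, hF₂₃, hdim₃, hRF', hRd', ht₂, ht₂'⟩ := ih (by omega) F₂ (update w jj d) a
      (u + w jj) (fun i => hF₁₂ (hupd d hdF₁ i)) (hF₁₂ (hFF₁ ha))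
      (hF₁₂ (hFF₁ (F.add_mem hu (hw jj)))) (linearIndependent_update hw hi hdF)
      (not_mem_range_update hw ha har hdF) (by omega)
    have e₁ : ∀ v, lc (update w jj v) '' lowFree H j = _ := image_lowFree_update (H := H) w jj
    have e₂ : lc w '' lowFree H (j + 1) = _ := image_lowFree_succ (H := H) w jj
    rw [e₁] at ht₁ ht₁' ht₂ ht₂'
    rw [e₂]
    set Z₀ := lc w '' {x | x jj = 0 ∧ x ∈ lowFree H jj} with hZ₀
    set Z₁ := lc w '' {x | x jj = 0 ∧ update x jj 1 ∈ lowFree H jj} with hZ₁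
    have hZ₀F : Z₀ ⊆ F := by
      rintro _ ⟨x, -, rfl⟩; exact linearCombination_mem hw x
    have hZ₁F : Z₁ ⊆ F := by
      rintro _ ⟨x, -, rfl⟩; exact linearCombination_mem hw x
    simp only [vadd_set_union, vadd_vadd] at ht₁ ht₁' ht₂ ht₂' ⊢
    have hww := add_self_of_zmod_two (w jj)
    have haa := add_self_of_zmod_two a
    have s₁ : u + w jj + d = u + a + c := by
      rw [hd]
      calc u + w jj + (w jj + a + c) = u + a + c + (w jj + w jj) := by abel
        _ = _ := by rw [hww, add_zero]
    have s₂ : u + w jj + a + d = u + c := by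
      rw [hd]
      calc u + w jj + a + (w jj + a + c) = u + c + (w jj + w jj) + (a + a) := by abel
        _ = _ := by rw [hww, haa, add_zero, add_zero]
    have s₃ : u + w jj + a = u + a + w jj := by abel
    rw [s₁] at ht₂
    rw [s₂, s₃] at ht₂'
    have hucF : u + c ∉ F := fun h => hc ((F.add_mem_iff_right hu).1 h)
    have hua : u + a ∈ F := F.add_mem hu ha
    have hucF' : u + a + c ∉ F := fun h => hc ((F.add_mem_iff_right hua).1 h)
    have d₁ := vadd_disjoint_of_not_mem hucF hZ₁F
    have d₂ := vadd_disjoint_of_not_mem hucF' hZ₁F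
    have m₁ : (u + c) +ᵥ Z₁ ⊆ F₁ := vadd_subset_of_mem (F₁.add_mem (hFF₁ hu) hcF₁)
      (hZ₁F.trans hFF₁)
    have m₂ : (u + a + c) +ᵥ Z₁ ⊆ F₁ := vadd_subset_of_mem (F₁.add_mem (hFF₁ hua) hcF₁)
      (hZ₁F.trans hFF₁)
    have n₁ : u +ᵥ Z₀ ⊆ F := vadd_subset_of_mem hu hZ₀F
    have n₂ : (u + w jj) +ᵥ Z₀ ⊆ F := vadd_subset_of_mem (F.add_mem hu (hw jj)) hZ₀F
    have n₃ : (u + a) +ᵥ Z₀ ⊆ F := vadd_subset_of_mem hua hZ₀F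
    have n₄ : (u + a + w jj) +ᵥ Z₀ ⊆ F := vadd_subset_of_mem (F.add_mem hua (hw jj)) hZ₀F
    have hZ₁Z₁ : Disjoint ((u + c) +ᵥ Z₁) ((u + a + c) +ᵥ Z₁) := by
      rw [Set.disjoint_left]
      rintro _ ⟨_, ⟨x, -, rfl⟩, rfl⟩ ⟨_, ⟨y, -, rfl⟩, h⟩
      apply har
      refine ⟨x - y, ?_⟩
      simp only [vadd_eq_add] at h
      rw [map_sub, sub_eq_iff_eq_add]
      have : (u + c) + (a + lc w y) = (u + c) + lc w x := by rw [← h]; abel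
      exact (add_left_cancel this).symm
    have hZ₀Z₀ : ∀ v : E, Disjoint (v +ᵥ Z₀) ((v + w jj) +ᵥ Z₀) := by
      intro v
      rw [Set.disjoint_left]
      rintro _ ⟨_, ⟨x, hx, rfl⟩, rfl⟩ ⟨_, ⟨y, hy, rfl⟩, h⟩
      simp only [vadd_eq_add, add_assoc] at h
      have h := add_left_cancel h
      have hs : w jj = lc w (Pi.single jj 1) := by
        simp [Fintype.linearCombination_apply_single]
      rw [hs, ← map_add] at h
      have := congrFun (hi h) jj
      simp [hx.1, hy.1] at this
    have hRR : Disjoint R R' := (hRd'.mono_right hRF).symm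
    refine ⟨R ∪ R' ∪ ((u + c) +ᵥ Z₁) ∪ ((u + a + c) +ᵥ Z₁), F₃, hFF₁.trans (hF₁₂.trans hF₂₃),
      by omega, ?_, ?_, ?_, ?_⟩
    · refine union_subset (union_subset (union_subset (hRF.trans hF₂₃) hRF') ?_) ?_
      · exact m₁.trans (hF₁₂.trans hF₂₃)
      · exact m₂.trans (hF₁₂.trans hF₂₃)
    · simp only [disjoint_union_left]
      exact ⟨⟨⟨hRd.mono_right hFF₁, hRd'.mono_right (hFF₁.trans hF₁₂)⟩, d₁⟩, d₂⟩
    · refine ht₁.union_regroup ht₂ ⟨hRR, ?_, ?_⟩ ⟨?_, hZ₀Z₀ u, ?_⟩ ⟨?_, ?_, hZ₁Z₁⟩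
      · exact hRd.mono_right (n₂.trans hFF₁)
      · exact hRd.mono_right m₂
      · exact (hRd'.mono_right (n₁.trans (hFF₁.trans hF₁₂))).symm
      · exact (d₂.mono_right n₁).symm
      · exact (hRd'.mono_right (m₁.trans hF₁₂)).symm
      · exact d₁.mono_right n₂
    · rw [union_right_comm (R ∪ R')]
      refine ht₁'.union_regroup ht₂' ⟨hRR, ?_, ?_⟩ ⟨?_, hZ₀Z₀ _, ?_⟩ ⟨?_, ?_, hZ₁Z₁.symm⟩
      · exact hRd.mono_right (n₄.trans hFF₁)
      · exact hRd.mono_right m₁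
      · exact (hRd'.mono_right (n₃.trans (hFF₁.trans hF₁₂))).symm
      · exact (d₁.mono_right n₃).symm
      · exact (hRd'.mono_right (m₂.trans hF₁₂)).symm
      · exact d₂.mono_right n₄

/-- Two parallel disjoint flats of dimension `k` are switchable. -/
theorem switchable_flats [FiniteDimensional (ZMod 2) E] (h0 : 0 ∈ H) (F : Submodule (ZMod 2) E)
    (w : Fin k → E) (a u : E) (hw : ∀ i, w i ∈ F) (ha : a ∈ F) (hu : u ∈ F)
    (hi : Injective (lc w)) (har : a ∉ range (lc w))
    (hF : finrank (ZMod 2) F + (2 ^ k - 1) ≤ finrank (ZMod 2) E) :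
    Switchable H (2 ^ k - 1) F (u +ᵥ range (lc w)) ((u + a) +ᵥ range (lc w)) := by
  have := switchable_lowFree (H := H) k le_rfl F w a u hw ha hu hi har hF
  rwa [lowFree_top h0, image_univ] at this

end Switch

/-! ### Greedy choices in unused dimensions. -/

section Fresh

open Module

variable {E V : Type*} [AddCommGroup E] [Module (ZMod 2) E]

/-- Greedy choice of pairwise disjoint sets, each of which costs at most `r` dimensions. -/
theorem exists_disjoint_family {ι : Type*} (T : ι → Set E → Prop) (r : ℕ)
    (F₀ : Submodule (ZMod 2) E) (s : Finset ι)
    (hs : finrank (ZMod 2) F₀ + s.card * r ≤ finrank (ZMod 2) E)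
    (hT : ∀ l ∈ s, ∀ F : Submodule (ZMod 2) E, F₀ ≤ F →
      finrank (ZMod 2) F + r ≤ finrank (ZMod 2) E →
      ∃ (R : Set E) (F' : Submodule (ZMod 2) E), F ≤ F' ∧
        finrank (ZMod 2) F' ≤ finrank (ZMod 2) F + r ∧ R ⊆ F' ∧ Disjoint R F ∧ T l R) :
    ∃ R : ι → Set E, (∀ l ∈ s, T l (R l) ∧ Disjoint (R l) F₀) ∧
      (s : Set ι).PairwiseDisjoint R := by
  classical
  suffices h : ∃ (R : ι → Set E) (F : Submodule (ZMod 2) E), F₀ ≤ F ∧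
      finrank (ZMod 2) F ≤ finrank (ZMod 2) F₀ + s.card * r ∧
      (∀ l ∈ s, T l (R l) ∧ Disjoint (R l) F₀ ∧ R l ⊆ F) ∧ (s : Set ι).PairwiseDisjoint R by
    obtain ⟨R, F, -, -, h, hd⟩ := h
    exact ⟨R, fun l hl => ⟨(h l hl).1, (h l hl).2.1⟩, hd⟩
  induction s using Finset.induction_on with
  | empty => exact ⟨fun _ => ∅, F₀, le_rfl, by simp, by simp, by simp⟩
  | insert l s hl ih =>
    rw [Finset.card_insert_of_notMem hl, add_mul, one_mul] at hs
    obtain ⟨R, F, hF₀, hdim, hR, hd⟩ := ih (by omega) fun l' hl' =>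
      hT l' (Finset.mem_insert_of_mem hl')
    obtain ⟨R', F', hFF', hdim', hR', hd', hT'⟩ :=
      hT l (Finset.mem_insert_self l s) F hF₀ (by omega)
    have hne : ∀ l' ∈ s, l' ≠ l := fun l' h h' => hl (h' ▸ h)
    refine ⟨update R l R', F', hF₀.trans hFF', ?_, ?_, ?_⟩
    · rw [Finset.card_insert_of_notMem hl, add_mul, one_mul]; omega
    · intro l' hl'
      rcases Finset.mem_insert.1 hl' with rfl | h
      · simpa using ⟨hT', hd'.mono_right hF₀, hR'⟩
      · rw [update_of_ne (hne l' h)]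
        exact ⟨(hR l' h).1, (hR l' h).2.1, (hR l' h).2.2.trans hFF'⟩
    · rw [Finset.coe_insert]
      refine (pairwiseDisjoint_insert_of_notMem (by simpa using hl)).2 ⟨?_, ?_⟩
      · intro a ha b hb hab
        simp only [onFun]
        rw [update_of_ne (hne a ha), update_of_ne (hne b hb)]
        exact hd ha hb hab
      · intro b hb
        rw [update_self, update_of_ne (hne b hb)]
        exact hd'.mono_right (hR b hb).2.2

variable [AddCommGroup V] [Module (ZMod 2) V] [FiniteDimensional (ZMod 2) V]

theorem exists_linearMap_fresh [FiniteDimensional (ZMod 2) E] (F : Submodule (ZMod 2) E)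
    (h : finrank (ZMod 2) F + finrank (ZMod 2) V ≤ finrank (ZMod 2) E) :
    ∃ θ : V →ₗ[ZMod 2] E, ∀ v, θ v ∈ F → v = 0 := by
  obtain ⟨Q, hQ⟩ := F.exists_isCompl
  have hdim := Submodule.finrank_add_eq_of_isCompl hQ
  have hVQ : finrank (ZMod 2) V ≤ finrank (ZMod 2) Q := by omega
  obtain ⟨f, hf⟩ := finrank_le_iff_exists_linearMap.1 hVQ
  refine ⟨Q.subtype ∘ₗ f, fun v hv => ?_⟩
  have : (f v : E) ∈ F ⊓ Q := ⟨hv, (f v).2⟩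
  rw [hQ.inf_eq_bot, Submodule.mem_bot] at this
  exact hf (Subtype.ext (by simpa using this))

theorem finrank_sup_range_le [FiniteDimensional (ZMod 2) E] (F : Submodule (ZMod 2) E)
    (θ : V →ₗ[ZMod 2] E) :
    finrank (ZMod 2) (F ⊔ LinearMap.range θ : Submodule (ZMod 2) E) ≤
      finrank (ZMod 2) F + finrank (ZMod 2) V := by
  refine (Submodule.finrank_add_le_finrank_add_finrank _ _).trans ?_
  gcongr
  exact LinearMap.finrank_range_le θ

end Fresh

/-! ### Absorbing a batch of parallel flats. -/

section Absorb

open Module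

variable {k : ℕ} {H : Finset (Fin k → ZMod 2)}

local notation "lc" => Fintype.linearCombination (ZMod 2)

/-- Take new parallel flats at positions τ h that form an affine copy of H; their union is tileable,
one copy of H for each point of the common direction. Let R h switch the flat at `u h` with the one
at τ h. The absorber consists of all R h and all new flats. Alone, it is tiled by the sets R h ∪
(flat at τ h); with the given flats, by the sets R h ∪ (flat at `u h`) and the tiling of the new
flats. -/
theorem exists_absorber_of_flats {E : Type*} [AddCommGroup E] [Module (ZMod 2) E]
    [FiniteDimensional (ZMod 2) E] (h0 : 0 ∈ H) (F : Submodule (ZMod 2) E) (w : Fin k → E)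
    (hw : ∀ i, w i ∈ F) (hi : Injective (lc w)) (u : (Fin k → ZMod 2) → E)
    (hu : ∀ h ∈ H, u h ∈ F)
    (hud : (H : Set (Fin k → ZMod 2)).PairwiseDisjoint fun h => u h +ᵥ range (lc w))
    (hF : finrank (ZMod 2) F + (k + 1) + H.card * (2 ^ k - 1) ≤ finrank (ZMod 2) E) :
    ∃ D : Set E, Disjoint D F ∧ Tileable (affTiles H E) D ∧
      Tileable (affTiles H E) (D ∪ ⋃ h ∈ H, (u h +ᵥ range (lc w))) := by
  -- The first factor carries the affine copy of H; the last coordinate, set to 1, keeps all of it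
  -- outside `F`.
  obtain ⟨θ, hθ⟩ := exists_linearMap_fresh (V := (Fin k → ZMod 2) × ZMod 2) F (by simp; omega)
  set F₀ := F ⊔ LinearMap.range θ with hF₀
  have hFF₀ : F ≤ F₀ := le_sup_left
  have hdim : finrank (ZMod 2) F₀ ≤ finrank (ZMod 2) F + (k + 1) := by
    simpa using finrank_sup_range_le F θ
  set τ : (Fin k → ZMod 2) → E := fun h => θ (h, 1) with hτ
  have hτF₀ : ∀ h, τ h ∈ F₀ := fun h => Submodule.mem_sup_right ⟨_, rfl⟩
  have hτF : ∀ h, τ h ∉ F := fun h hh => by simpa using congrArg Prod.snd (hθ _ hh)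
  have hKF : range (lc w) ⊆ F := by
    rintro _ ⟨x, rfl⟩; exact linearCombination_mem hw x
  have hτd : Pairwise (Disjoint on fun h => τ h +ᵥ range (lc w)) := by
    intro h h' hne
    rw [onFun, Set.disjoint_left]
    rintro _ ⟨x, hx, rfl⟩ ⟨y, hy, hxy⟩
    apply hne
    have : θ ((h, 1) - (h', 1)) ∈ F := by
      rw [map_sub]
      simp only [vadd_eq_add, hτ] at hxy
      have : θ (h, 1) - θ (h', 1) = y - x := by
        rw [sub_eq_sub_iff_add_eq_add, ← hxy, add_comm]
      rw [this]
      exact F.sub_mem (hKF hy) (hKF hx)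
    have := congrArg Prod.fst (hθ _ this)
    exact sub_eq_zero.1 (by simpa using this)
  obtain ⟨R, hR, hRd⟩ := exists_disjoint_family
    (fun h R => Tileable (affTiles H E) (R ∪ (u h +ᵥ range (lc w))) ∧
      Tileable (affTiles H E) (R ∪ (τ h +ᵥ range (lc w)))) (2 ^ k - 1) F₀ H (by omega) (by
      intro h hh F₁ hF₁ hdim₁
      have hu₁ := hF₁ (hFF₀ (hu h hh))
      obtain ⟨R, F', h₁, h₂, h₃, h₄, h₅, h₆⟩ := switchable_flats h0 F₁ w (τ h - u h) (u h)
        (fun i => hF₁ (hFF₀ (hw i))) (F₁.sub_mem (hF₁ (hτF₀ h)) hu₁) hu₁ hi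
        (fun hx => hτF h (by
          rw [← sub_add_cancel (τ h) (u h)]
          exact F.add_mem (hKF hx) (hu h hh))) hdim₁
      rw [add_sub_cancel] at h₆
      exact ⟨R, F', h₁, h₂, h₃, h₄, h₅, h₆⟩)
  have huF₀ : ∀ h ∈ H, u h +ᵥ range (lc w) ⊆ F := fun h hh => vadd_subset_of_mem (hu h hh) hKF
  have hτF₀' : ∀ h, τ h +ᵥ range (lc w) ⊆ F₀ := fun h =>
    vadd_subset_of_mem (hτF₀ h) (hKF.trans hFF₀)
  have hτF' : ∀ h, Disjoint (τ h +ᵥ range (lc w)) (F : Set E) := fun h =>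
    vadd_disjoint_of_not_mem (hτF h) hKF
  have hZ : Tileable (affTiles H E) (⋃ h ∈ H, (τ h +ᵥ range (lc w))) := by
    have : (⋃ h ∈ H, (τ h +ᵥ range (lc w))) =
        ⋃ x, (fun h => (lc w x + θ (0, 1)) + (θ ∘ₗ LinearMap.inl _ _ _) h) '' (H : Set _) := by
      have key : ∀ x h, (lc w x + θ (0, 1)) + θ (h, 0) = τ h + lc w x := by
        intro x h
        rw [add_assoc, ← map_add, add_comm]
        simp [hτ]
      ext y
      simp only [mem_iUnion, mem_vadd_set, mem_image, LinearMap.comp_apply,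
        LinearMap.inl_apply, key]
      simp only [mem_range, vadd_eq_add, Finset.mem_coe]
      constructor
      · rintro ⟨h, hh, _, ⟨x, rfl⟩, rfl⟩
        exact ⟨x, h, hh, rfl⟩
      · rintro ⟨x, h, hh, rfl⟩
        exact ⟨h, hh, _, ⟨x, rfl⟩, rfl⟩
    rw [this]
    refine Tileable.iUnion ?_ fun x => Tileable.of_mem ⟨_, _, ?_, rfl⟩
    · intro x y hxy
      rw [onFun, Set.disjoint_left]
      rintro _ ⟨h, hh, rfl⟩ ⟨h', hh', he⟩
      apply hxy
      simp only [LinearMap.comp_apply, LinearMap.inl_apply, add_right_comm _ (θ (0, 1))] at he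
      have he := add_right_cancel he
      have h₁ : θ ((h', 0) - (h, 0)) ∈ F := by
        rw [map_sub]
        have : θ (h', 0) - θ (h, 0) = lc w x - lc w y := by
          rw [sub_eq_sub_iff_add_eq_add, add_comm, he, add_comm]
        rw [this]
        exact F.sub_mem (hKF ⟨_, rfl⟩) (hKF ⟨_, rfl⟩)
      have := congrArg Prod.fst (hθ _ h₁)
      have : h' = h := sub_eq_zero.1 (by simpa using this)
      subst this
      exact hi (add_right_cancel he).symm
    · rw [← LinearMap.ker_eq_bot, LinearMap.ker_eq_bot']
      intro x hx
      have := hθ (x, 0) (by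
        have : θ (x, 0) = 0 := by simpa using hx
        rw [this]; exact F.zero_mem)
      simpa using this
  refine ⟨⋃ h ∈ H, (R h ∪ (τ h +ᵥ range (lc w))), ?_, ?_, ?_⟩
  · simp only [disjoint_iUnion_left, disjoint_union_left]
    exact fun h hh => ⟨(hR h hh).2.mono_right hFF₀, hτF' h⟩
  · refine Tileable.biUnion (s := (H : Set _)) ?_ fun h hh => (hR h hh).1.2
    intro h hh h' hh' hne
    simp only [onFun, disjoint_union_left, disjoint_union_right]
    exact ⟨⟨hRd hh hh' hne, ((hR h' hh').2.mono_right (hτF₀' h)).symm⟩,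
      (hR h hh).2.mono_right (hτF₀' h'), hτd hne⟩
  · have h₁ : Tileable (affTiles H E) (⋃ h ∈ H, (R h ∪ (u h +ᵥ range (lc w)))) := by
      refine Tileable.biUnion (s := (H : Set _)) ?_ fun h hh => (hR h hh).1.1
      intro h hh h' hh' hne
      simp only [onFun, disjoint_union_left, disjoint_union_right]
      exact ⟨⟨hRd hh hh' hne, ((hR h' hh').2.mono_right ((huF₀ h hh).trans hFF₀)).symm⟩,
        (hR h hh).2.mono_right ((huF₀ h' hh').trans hFF₀), hud hh hh' hne⟩
    have hd : Disjoint (⋃ h ∈ H, (R h ∪ (u h +ᵥ range (lc w))))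
        (⋃ h ∈ H, (τ h +ᵥ range (lc w))) := by
      simp only [disjoint_iUnion_left, disjoint_iUnion_right, disjoint_union_left]
      exact fun h hh h' hh' => ⟨(hR h' hh').2.mono_right (hτF₀' h),
        ((hτF' h).mono_right (huF₀ h' hh')).symm⟩
    convert h₁.union hd hZ using 1
    simp only [iUnion_union_distrib, Set.union_assoc]
    rw [Set.union_comm (⋃ h ∈ H, (τ h +ᵥ range (lc w)))]

/-- The number of auxiliary dimensions that are used to absorb `H.card` parallel flats. -/
def absorbDim (H : Finset (Fin k → ZMod 2)) : ℕ := k + 1 + H.card * (2 ^ k - 1)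

theorem exists_absorber (h0 : 0 ∈ H) {G : Type*} [AddCommGroup G] [Module (ZMod 2) G]
    [FiniteDimensional (ZMod 2) G] (g : (Fin k → ZMod 2) → G) (hg : InjOn g H) :
    ∃ D : Set (((Fin k → ZMod 2) × G) × (Fin (absorbDim H) → ZMod 2)), (∀ y ∈ D, y.2 ≠ 0) ∧
      Tileable (affTiles H _) D ∧
      Tileable (affTiles H _) (D ∪ {y | y.2 = 0 ∧ y.1.2 ∈ g '' H}) := by
  let E := ((Fin k → ZMod 2) × G) × (Fin (absorbDim H) → ZMod 2)
  let F : Submodule (ZMod 2) E := LinearMap.range (LinearMap.inl _ _ _)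
  have hF : ∀ y : E, y ∈ F ↔ y.2 = 0 := by
    intro y
    constructor
    · rintro ⟨x, rfl⟩; rfl
    · intro h; exact ⟨y.1, Prod.ext rfl h.symm⟩
  let w : Fin k → E := fun i => ((Pi.single i 1, 0), 0)
  have hlc : ∀ x, lc w x = ((x, 0), 0) := by
    intro x
    rw [Fintype.linearCombination_apply]
    refine Prod.ext (Prod.ext ?_ ?_) ?_
    · rw [Prod.fst_sum, Prod.fst_sum]
      exact (pi_eq_sum_univ' x).symm
    · rw [Prod.fst_sum, Prod.snd_sum]
      exact Finset.sum_eq_zero fun i _ => smul_zero _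
    · rw [Prod.snd_sum]
      exact Finset.sum_eq_zero fun i _ => smul_zero _
  have hdim : finrank (ZMod 2) F = finrank (ZMod 2) ((Fin k → ZMod 2) × G) :=
    LinearMap.finrank_range_of_inj LinearMap.inl_injective
  have hflat : ∀ (c : G) (y : E),
      y ∈ (((0, c), 0) : E) +ᵥ range (lc w) ↔ y.2 = 0 ∧ y.1.2 = c := by
    intro c y
    simp only [mem_vadd_set, mem_range, vadd_eq_add, exists_exists_eq_and, hlc]
    constructor
    · rintro ⟨x, rfl⟩; simp
    · rintro ⟨h₁, h₂⟩
      exact ⟨y.1.1, Prod.ext (Prod.ext (by simp) (by simp [h₂])) (by simp [h₁])⟩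
  obtain ⟨D, hD, hD₁, hD₂⟩ := exists_absorber_of_flats h0 F w (fun i => (hF _).2 rfl)
    (fun x y h => by
      rw [hlc, hlc] at h
      exact congrArg (fun y : E => y.1.1) h) (fun h => ((0, g h), 0)) (fun h _ => (hF _).2 rfl)
    (by
      intro h hh h' hh' hne
      rw [onFun, Set.disjoint_left]
      intro y hy hy'
      rw [hflat] at hy hy'
      exact hne (hg hh hh' (hy.2.symm.trans hy'.2)))
    (by
      rw [hdim]
      change _ ≤ finrank (ZMod 2) (((Fin k → ZMod 2) × G) × (Fin (absorbDim H) → ZMod 2))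
      rw [finrank_prod (M := (Fin k → ZMod 2) × G), finrank_fin_fun, absorbDim]
      omega)
  refine ⟨D, fun y hy h => Set.disjoint_left.1 hD hy ((hF y).2 h), hD₁, ?_⟩
  convert hD₂ using 2
  ext y
  simp only [mem_iUnion, hflat, mem_ofPred_eq, mem_image, Finset.mem_coe]
  constructor
  · rintro ⟨h, x, hx, hxy⟩; exact ⟨x, hx, h, hxy.symm⟩
  · rintro ⟨x, hx, h, hxy⟩; exact ⟨h, x, hx, hxy.symm⟩

end Absorb

/-! ### Placing absorbers in layers of a given colour. -/

section Colour

open Module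

variable {k : ℕ} {H : Finset (Fin k → ZMod 2)} {A G V ι : Type*}
  [AddCommGroup A] [Module (ZMod 2) A]
  [AddCommGroup G] [Module (ZMod 2) G] [FiniteDimensional (ZMod 2) G]
  [AddCommGroup V] [Module (ZMod 2) V] [FiniteDimensional (ZMod 2) V]

/-- The colour of a pair that consists of an address and a table of colours. -/
def colour {A S : Type*} (γ : A × (A → S)) : S := γ.2 γ.1

/-- Each entry of the table can be treated separately: injectivity of `π` leaves at most one
relevant vector per address, and a functional equal to 1 on it gives the required value. -/
theorem exists_table_map (π : V →ₗ[ZMod 2] A) (hπ : Injective π) (p : A)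
    (t : A → Fin k → ZMod 2) :
    ∃ α : V →ₗ[ZMod 2] (A → Fin k → ZMod 2), ∀ v ≠ 0, α v (p + π v) = t (p + π v) := by
  classical
  have h : ∀ x : A, ∃ α : V →ₗ[ZMod 2] (Fin k → ZMod 2), ∀ v ≠ 0, x = p + π v → α v = t x := by
    intro x
    by_cases hx : ∃ v ≠ 0, x = p + π v
    · obtain ⟨v, hv, rfl⟩ := hx
      obtain ⟨f, hf⟩ := Module.Projective.exists_dual_eq_one (ZMod 2) hv
      refine ⟨f.smulRight (t (p + π v)), fun v' _ h => ?_⟩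
      rw [← hπ (add_left_cancel h), LinearMap.smulRight_apply, hf, one_smul]
    · push Not at hx
      exact ⟨0, fun v hv h => absurd h (hx v hv)⟩
  choose α hα using h
  exact ⟨LinearMap.pi α, fun v hv => hα _ v hv rfl⟩

/-- A nonzero vector moves the address, and the table is corrected linearly at the new address so
that the colour read there is `c`. The new addresses for different indices are chosen in fresh
dimensions, which makes the images disjoint. -/
theorem exists_colour_maps [FiniteDimensional (ZMod 2) A]
    (γ : ι → A × (A → Fin k → ZMod 2)) (s : Finset ι)
    (c : Fin k → ZMod 2)
    (hdim : s.card * (1 + finrank (ZMod 2) V) ≤ finrank (ZMod 2) A) :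
    ∃ lam : ι → V →ₗ[ZMod 2] A × (A → Fin k → ZMod 2),
      (∀ l ∈ s, Injective (lam l) ∧ ∀ v ≠ 0, colour (γ l + lam l v) = c) ∧
      ∀ l ∈ s, ∀ l' ∈ s, l ≠ l' → ∀ v ≠ 0, ∀ v' ≠ 0, γ l + lam l v ≠ γ l' + lam l' v' := by
  classical
  -- Including all base addresses costs at most `s.card` dimensions and ensures that translating by
  -- one of them preserves freshness.
  let F₀ : Submodule (ZMod 2) A := Submodule.span (ZMod 2) (s.image fun l => (γ l).1 : Finset A)
  have hF₀ : finrank (ZMod 2) F₀ ≤ s.card :=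
    (finrank_span_finset_le_card _).trans Finset.card_image_le
  have hp : ∀ l ∈ s, (γ l).1 ∈ F₀ := fun l hl =>
    Submodule.subset_span (by simpa using ⟨l, hl, rfl⟩)
  obtain ⟨R, hR, hRd⟩ := exists_disjoint_family
    (fun l R => ∃ lam : V →ₗ[ZMod 2] A × (A → Fin k → ZMod 2), Injective lam ∧
      ∀ v ≠ 0, colour (γ l + lam v) = c ∧ (γ l + lam v).1 ∈ R) (finrank (ZMod 2) V) F₀ s
    (by rw [mul_add, mul_one] at hdim; omega) (by
      intro l hl F hF hdimF
      obtain ⟨π, hπ⟩ := exists_linearMap_fresh (V := V) F hdimF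
      have hπi : Injective π := by
        rw [← LinearMap.ker_eq_bot, LinearMap.ker_eq_bot']
        exact fun v hv => hπ v (by rw [hv]; exact F.zero_mem)
      obtain ⟨α, hα⟩ := exists_table_map π hπi (γ l).1 (fun x => c - (γ l).2 x)
      refine ⟨{x | ∃ v ≠ 0, x = (γ l).1 + π v}, F ⊔ LinearMap.range π, le_sup_left,
        finrank_sup_range_le F π, ?_, ?_, π.prod α, ?_, ?_⟩
      · rintro _ ⟨v, -, rfl⟩
        exact Submodule.add_mem _ (Submodule.mem_sup_left (hF (hp l hl)))
          (Submodule.mem_sup_right ⟨v, rfl⟩)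
      · rw [Set.disjoint_left]
        rintro _ ⟨v, hv, rfl⟩ h
        exact hv (hπ v ((F.add_mem_iff_right (hF (hp l hl))).1 h))
      · intro v v' h
        exact hπi (congrArg Prod.fst h)
      · intro v hv
        refine ⟨?_, v, hv, rfl⟩
        simp only [colour, Prod.fst_add, Prod.snd_add, LinearMap.prod_apply, Pi.add_apply,
          Function.prod_apply]
        rw [hα v hv]
        abel)
  choose! lam hlam using fun l hl => (hR l hl).1
  refine ⟨lam, fun l hl => ⟨(hlam l hl).1, fun v hv => ((hlam l hl).2 v hv).1⟩, ?_⟩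
  intro l hl l' hl' hne v hv v' hv' h
  refine Set.disjoint_left.1 (hRd hl hl' hne) ((hlam l hl).2 v hv).2 ?_
  rw [h]
  exact ((hlam l' hl').2 v' hv').2

theorem exists_disjoint_absorbers [FiniteDimensional (ZMod 2) A] (h0 : 0 ∈ H) (s : Finset ι)
    (γ : ι → A × (A → Fin k → ZMod 2)) (g : ι → (Fin k → ZMod 2) → G)
    (hg : ∀ l ∈ s, InjOn (g l) H) (c : Fin k → ZMod 2)
    (hdim : s.card * (1 + absorbDim H) ≤ finrank (ZMod 2) A) :
    ∃ D : ι → Set (((Fin k → ZMod 2) × G) × A × (A → Fin k → ZMod 2)),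
      (∀ l ∈ s, (∀ y ∈ D l, colour y.2 = c) ∧ Tileable (affTiles H _) (D l) ∧
        Tileable (affTiles H _) (D l ∪ {y | y.2 = γ l ∧ y.1.2 ∈ g l '' H})) ∧
      (s : Set ι).PairwiseDisjoint D := by
  obtain ⟨lam, hlam, hdis⟩ := exists_colour_maps (V := Fin (absorbDim H) → ZMod 2) γ s c
    (by simpa using hdim)
  choose! D hD₀ hD₁ hD₂ using fun l (hl : l ∈ s) => exists_absorber h0 (g l) (hg l hl)
  let Φ : ι → _ := fun l => LinearMap.prodMap (LinearMap.id : ((Fin k → ZMod 2) × G) →ₗ[ZMod 2] _)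
    (lam l)
  have hΦ : ∀ l ∈ s, Injective (Φ l) := fun l hl =>
    Prod.map_injective.2 ⟨injective_id, (hlam l hl).1⟩
  refine ⟨fun l => (fun y => (0, γ l) + Φ l y) '' D l, fun l hl => ⟨?_, ?_, ?_⟩, ?_⟩
  · rintro _ ⟨y, hy, rfl⟩
    exact (hlam l hl).2 _ (hD₀ l hl y hy)
  · exact (hD₁ l hl).affine_image (Φ l) (hΦ l hl) _
  · convert (hD₂ l hl).affine_image (Φ l) (hΦ l hl) (0, γ l) using 1
    rw [image_union]
    congr 1
    ext y
    simp only [mem_image, mem_ofPred_eq]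
    constructor
    · rintro ⟨h₁, h₂⟩
      refine ⟨(y.1, 0), ⟨rfl, h₂⟩, Prod.ext ?_ ?_⟩
      · simp [Φ]
      · simp [Φ, h₁]
    · rintro ⟨x, ⟨h₁, h₂⟩, rfl⟩
      simpa [Φ, h₁] using h₂
  · intro l hl l' hl' hne
    rw [onFun, Set.disjoint_left]
    rintro _ ⟨y, hy, rfl⟩ ⟨y', hy', h⟩
    exact hdis l hl l' hl' hne _ (hD₀ l hl y hy) _ (hD₀ l' hl' y' hy') (congrArg Prod.snd h).symm

end Colour

/-! ### Tilings of slices of a product. -/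

section Product

variable {k : ℕ} {H : Finset (Fin k → ZMod 2)} {Y Z : Type*} [AddCommGroup Y] [Module (ZMod 2) Y]
  [AddCommGroup Z] [Module (ZMod 2) Z]

theorem Tileable.prod_singleton {X : Set Y} (hX : Tileable (affTiles H Y) X) (z : Z) :
    Tileable (affTiles H (Y × Z)) (X ×ˢ {z}) := by
  convert hX.affine_image (LinearMap.inl (ZMod 2) Y Z) LinearMap.inl_injective (0, z) using 1
  ext ⟨a, b⟩
  simp [eq_comm]

theorem Tileable.singleton_prod {X : Set Z} (hX : Tileable (affTiles H Z) X) (y : Y) :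
    Tileable (affTiles H (Y × Z)) ({y} ×ˢ X) := by
  convert hX.affine_image (LinearMap.inr (ZMod 2) Y Z) LinearMap.inr_injective (y, 0) using 1
  ext ⟨a, b⟩
  simp [eq_comm, and_comm]

theorem tileable_translate (c : Fin k → ZMod 2) :
    Tileable (affTiles H (Fin k → ZMod 2)) {x | x + c ∈ H} := by
  refine Tileable.of_mem ⟨LinearMap.id, c, injective_id, ?_⟩
  ext x
  simp only [mem_ofPred_eq, LinearMap.id_apply, mem_image, Finset.mem_coe]
  constructor
  · intro h
    exact ⟨_, h, by rw [add_comm x, ← add_assoc, add_self_of_zmod_two, zero_add]⟩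
  · rintro ⟨h, hh, rfl⟩
    rwa [add_comm c, add_assoc, add_self_of_zmod_two, add_zero]

end Product

/-! ### Using one colour class to absorb batches. -/

section Slice

open Module

variable {k : ℕ} {H : Finset (Fin k → ZMod 2)} {A G ι : Type*}
  [AddCommGroup A] [Module (ZMod 2) A] [FiniteDimensional (ZMod 2) A]
  [AddCommGroup G] [Module (ZMod 2) G] [FiniteDimensional (ZMod 2) G]

/-- The layers of colour `c` are used to absorb some batches that lie in layers of other
colours. -/
theorem tileable_colour_class_union (h0 : 0 ∈ H) (s : Finset ι)
    (γ : ι → A × (A → Fin k → ZMod 2)) (g : ι → (Fin k → ZMod 2) → G)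
    (hg : ∀ l ∈ s, InjOn (g l) H) (c : Fin k → ZMod 2) (hγ : ∀ l ∈ s, colour (γ l) ≠ c)
    (hd : (s : Set ι).PairwiseDisjoint
      fun l => ({y | y.2 = γ l ∧ y.1.2 ∈ g l '' H} :
        Set (((Fin k → ZMod 2) × G) × A × (A → Fin k → ZMod 2))))
    (hdim : s.card * (1 + absorbDim H) ≤ finrank (ZMod 2) A) :
    Tileable (affTiles H ((((Fin k → ZMod 2) × G) × A × (A → Fin k → ZMod 2)) × (Fin k → ZMod 2)))
      {y | (colour y.1.2 = c ∧ y.2 + c ∈ H) ∨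
        (y.2 = c ∧ ∃ l ∈ s, y.1.2 = γ l ∧ y.1.1.2 ∈ g l '' H)} := by
  obtain ⟨D, hD, hDd⟩ := exists_disjoint_absorbers h0 s γ g hg c hdim
  let B : ι → Set (((Fin k → ZMod 2) × G) × A × (A → Fin k → ZMod 2)) :=
    fun l => {y | y.2 = γ l ∧ y.1.2 ∈ g l '' H}
  have hBc : ∀ l ∈ s, ∀ y ∈ B l, colour y.2 ≠ c := by
    rintro l hl y ⟨h, -⟩
    rw [h]; exact hγ l hl
  -- Away from the absorbers, tile in the direction of the last factor by the translate c + H.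
  have h₁ : Tileable (affTiles H _) (⋃ y ∈ {y | colour y.2 = c ∧ ∀ l ∈ s, y ∉ D l},
      ({y} : Set (((Fin k → ZMod 2) × G) × A × (A → Fin k → ZMod 2))) ×ˢ {x | x + c ∈ H}) := by
    refine Tileable.biUnion ?_ fun y _ => (tileable_translate c).singleton_prod y
    intro y _ y' _ hne
    exact Set.Disjoint.set_prod_left (by simpa using hne) _ _
  -- Over an absorber, tile every level x of c + H separately. The level x = c is among them because
  -- 0 ∈ H, and there the absorber takes in its batch.
  have h₂ : Tileable (affTiles H _) (⋃ p ∈ {p : ι × (Fin k → ZMod 2) | p.1 ∈ s ∧ p.2 + c ∈ H},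
      {y | y ∈ D p.1 ∨ (p.2 = c ∧ y ∈ B p.1)} ×ˢ {p.2}) := by
    refine Tileable.biUnion ?_ ?_
    · rintro ⟨l, x⟩ ⟨hl, -⟩ ⟨l', x'⟩ ⟨hl', -⟩ hne
      rw [onFun, Set.disjoint_left]
      rintro ⟨y, z⟩ ⟨hy, rfl⟩ ⟨hy', h⟩
      obtain rfl : z = x' := h
      have hll : l ≠ l' := fun h => hne (by rw [h])
      simp only [mem_ofPred_eq] at hy hy'
      rcases hy with hy | ⟨-, hy⟩ <;> rcases hy' with hy' | ⟨-, hy'⟩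
      · exact Set.disjoint_left.1 (hDd hl hl' hll) hy hy'
      · exact hBc l' hl' y hy' ((hD l hl).1 y hy)
      · exact hBc l hl y hy ((hD l' hl').1 y hy')
      · exact Set.disjoint_left.1 (hd hl hl' hll) hy hy'
    · rintro ⟨l, x⟩ ⟨hl, -⟩
      refine Tileable.prod_singleton ?_ x
      by_cases hx : x = c
      · convert (hD l hl).2.2 using 1
        ext y
        simp [hx, B]
      · convert (hD l hl).2.1 using 1
        ext y
        simp [hx]
  convert h₁.union ?_ h₂ using 1
  · ext ⟨y, x⟩
    simp only [mem_ofPred_eq, mem_union, mem_iUnion, mem_prod, mem_singleton_iff, exists_prop, B]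
    constructor
    · rintro (⟨hc, hx⟩ | ⟨rfl, l, hl, hy⟩)
      · by_cases hy : ∀ l ∈ s, y ∉ D l
        · exact Or.inl ⟨y, ⟨hc, hy⟩, rfl, hx⟩
        · push Not at hy
          obtain ⟨l, hl, hy⟩ := hy
          exact Or.inr ⟨(l, x), ⟨hl, hx⟩, Or.inl hy, rfl⟩
      · exact Or.inr ⟨(l, x), ⟨hl, by rwa [add_self_of_zmod_two]⟩, Or.inr ⟨rfl, hy⟩, rfl⟩
    · rintro (⟨_, ⟨hc, -⟩, rfl, hx⟩ | ⟨⟨l, _⟩, ⟨hl, hx⟩, hy | ⟨h, hy⟩, rfl⟩)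
      · exact Or.inl ⟨hc, hx⟩
      · exact Or.inl ⟨(hD l hl).1 y hy, hx⟩
      · exact Or.inr ⟨h, l, hl, hy⟩
  · rw [Set.disjoint_left]
    rintro ⟨y, x⟩ h h'
    simp only [mem_ofPred_eq, mem_iUnion, mem_prod, mem_singleton_iff, exists_prop] at h h'
    obtain ⟨_, ⟨hc, hy⟩, rfl, -⟩ := h
    obtain ⟨⟨l, _⟩, ⟨hl, -⟩, hy' | ⟨-, hy'⟩, -⟩ := h'
    · exact hy l hl hy'
    · exact hBc l hl y hy' hc

end Slice

/-! ### Layers that may be left out. -/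

section Flex

open Module

variable {k : ℕ} {H : Finset (Fin k → ZMod 2)}

/-- Add the blocks one at a time: the points gained with block `a` are tiled by moving in block `a`
alone, since the condition that the earlier blocks fail does not involve it. -/
theorem tileable_exists_block {I : Type*} [Fintype I] (v : I → Fin k → ZMod 2) :
    Tileable (affTiles H (I → Fin k → ZMod 2)) {x | ∃ i, x i + v i ∈ H} := by
  classical
  suffices h : ∀ s : Finset I,
      Tileable (affTiles H (I → Fin k → ZMod 2)) {x | ∃ i ∈ s, x i + v i ∈ H} by
    simpa using h Finset.univ
  intro s
  induction s using Finset.induction_on with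
  | empty => simpa using Tileable.empty
  | insert a s ha ih =>
    have h : Tileable (affTiles H (I → Fin k → ZMod 2))
        {x | x a + v a ∈ H ∧ ∀ i ∈ s, x i + v i ∉ H} := by
      refine Tileable.of_fibers (fun x => update x a 0) fun z => ?_
      by_cases hz : z a = 0 ∧ ∀ i ∈ s, z i + v i ∉ H
      · convert (tileable_translate (H := H) (v a)).affine_image
          (LinearMap.single (ZMod 2) (fun _ : I => Fin k → ZMod 2) a)
          (fun p q h => Pi.single_injective (M := fun _ : I => Fin k → ZMod 2) a h) z using 1
        ext x
        simp only [mem_inter_iff, mem_ofPred_eq, mem_preimage, mem_singleton_iff, mem_image,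
          LinearMap.single_apply]
        constructor
        · rintro ⟨⟨h₁, -⟩, rfl⟩
          refine ⟨x a, h₁, ?_⟩
          ext1 i
          by_cases hi : i = a
          · subst hi; simp
          · simp [hi]
        · rintro ⟨y, hy, rfl⟩
          refine ⟨⟨by simpa [hz.1] using hy, fun i hi => ?_⟩, ?_⟩
          · have : i ≠ a := fun h => ha (h ▸ hi)
            simpa [this] using hz.2 i hi
          · ext1 i
            by_cases hi : i = a
            · subst hi; simp [hz.1]
            · simp [hi]
      · convert Tileable.empty using 1
        rw [eq_empty_iff_forall_notMem]
        rintro x ⟨⟨-, h⟩, rfl⟩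
        refine hz ⟨by simp, fun i hi => ?_⟩
        have : i ≠ a := fun h => ha (h ▸ hi)
        simpa [this] using h i hi
    convert h.union ?_ ih using 1
    · ext x
      simp only [Finset.mem_insert, mem_ofPred_eq, mem_union]
      constructor
      · rintro ⟨i, rfl | hi, hx⟩
        · by_cases h' : ∃ j ∈ s, x j + v j ∈ H
          · exact Or.inr h'
          · push Not at h'
            exact Or.inl ⟨hx, h'⟩
        · exact Or.inr ⟨i, hi, hx⟩
      · rintro (⟨h, -⟩ | ⟨i, hi, h⟩)
        · exact ⟨a, Or.inl rfl, h⟩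
        · exact ⟨i, Or.inr hi, h⟩
    · rw [Set.disjoint_left]
      rintro x ⟨-, h⟩ ⟨i, hi, h'⟩
      exact h i hi h'

variable {A G I β : Type*}
  [AddCommGroup A] [Module (ZMod 2) A] [FiniteDimensional (ZMod 2) A]
  [AddCommGroup G] [Module (ZMod 2) G] [FiniteDimensional (ZMod 2) G]

/-- The points over the layer `g` that are neither covered by the colour classes nor by a block
of the last factor. -/
def holes (H : Finset (Fin k → ZMod 2)) (A I : Type*) {G : Type*} (g : G) :
    Set (((((Fin k → ZMod 2) × G) × A × (A → Fin k → ZMod 2)) × (Fin k → ZMod 2)) ×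
      (I → Fin k → ZMod 2)) :=
  {y | y.1.1.1.2 = g ∧ y.1.2 + colour y.1.1.2 ∉ H ∧ ∀ i, y.2 i ∉ H}

/-- Layers outside `J` are grouped into batches of |H|. A point not covered by its colour class is
covered through a block of the last factor whenever possible; otherwise, if its layer is outside
`J`, its batch is absorbed. The shifts `v` serve to leave few batches for each absorption, while
shift 0 on `J` leaves exactly the holes. -/
theorem tileable_compl_holes_of_batches [Fintype I] [Finite A] [Finite β] (h0 : 0 ∈ H)
    (hdim : 2 ^ k * (1 + absorbDim H) ≤ finrank (ZMod 2) A)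
    (J : Set G) (e : {g // g ∉ J} ≃ β × H)
    (v : β × A × (A → Fin k → ZMod 2) → I → Fin k → ZMod 2)
    (hv : ∀ r : (Fin k → ZMod 2) → β × A × (A → Fin k → ZMod 2), Injective r →
      ∃ i, ∀ s, v (r s) i = s) :
    Tileable (affTiles H (((((Fin k → ZMod 2) × G) × A × (A → Fin k → ZMod 2)) ×
      (Fin k → ZMod 2)) × (I → Fin k → ZMod 2))) (⋃ g ∈ J, holes H A I g)ᶜ := by
  classical
  have := Fintype.ofFinite A
  have := Fintype.ofFinite β
  let v' : ((Fin k → ZMod 2) × G) × A × (A → Fin k → ZMod 2) → I → Fin k → ZMod 2 :=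
    fun w => if h : w.1.2 ∈ J then 0 else v ((e ⟨w.1.2, h⟩).1, w.2)
  have hP₂ : Tileable (affTiles H (((((Fin k → ZMod 2) × G) × A × (A → Fin k → ZMod 2)) ×
      (Fin k → ZMod 2)) × (I → Fin k → ZMod 2)))
      {y | y.1.2 + colour y.1.1.2 ∉ H ∧ ∃ i, y.2 i + v' y.1.1 i ∈ H} := by
    refine Tileable.of_fibers Prod.fst fun p => ?_
    by_cases hp : p.2 + colour p.1.2 ∉ H
    · convert (tileable_exists_block (H := H) (v' p.1)).singleton_prod p using 1
      ext ⟨p', x⟩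
      simp only [mem_inter_iff, mem_ofPred_eq, mem_preimage, mem_singleton_iff, mem_prod]
      constructor
      · rintro ⟨⟨-, h⟩, rfl⟩
        exact ⟨rfl, h⟩
      · rintro ⟨rfl, h⟩
        exact ⟨⟨hp, h⟩, rfl⟩
    · convert Tileable.empty using 1
      rw [eq_empty_iff_forall_notMem]
      rintro x ⟨⟨h, -⟩, rfl⟩
      exact hp h
  have hP₁ : Tileable (affTiles H (((((Fin k → ZMod 2) × G) × A × (A → Fin k → ZMod 2)) ×
      (Fin k → ZMod 2)) × (I → Fin k → ZMod 2)))
      {y | y.1.2 + colour y.1.1.2 ∈ H ∨ (y.1.2 + colour y.1.1.2 ∉ H ∧ y.1.1.1.2 ∉ J ∧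
        ∀ i, y.2 i + v' y.1.1 i ∉ H)} := by
    -- The second component is the colour whose class does the covering: the point's own colour, or
    -- for an absorbed point its coordinate in the factor (Fin k → ZMod 2), which is the level at
    -- which that class absorbs.
    refine Tileable.of_fibers (fun y => (y.2, if y.1.2 + colour y.1.1.2 ∈ H then colour y.1.1.2
      else y.1.2)) ?_
    rintro ⟨x, c⟩
    let s : Finset (β × A × (A → Fin k → ZMod 2)) :=
      Finset.univ.filter fun l => c + colour l.2 ∉ H ∧ ∀ i, x i + v l i ∉ H
    -- Among 2^k distinct batches indexed by all vectors, some block `i` shifts batch `t` by exactly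
    -- `t`. The batch with t = `x i` is then covered in that block, as 0 ∈ H.
    have hs : s.card ≤ 2 ^ k := by
      by_contra! hlt
      have hcard : Fintype.card (Fin k → ZMod 2) ≤ Fintype.card s := by
        simpa using hlt.le
      obtain ⟨r⟩ := Function.Embedding.nonempty_of_card_le hcard
      obtain ⟨i, hi⟩ := hv (fun t => (r t : β × A × (A → Fin k → ZMod 2)))
        (Subtype.val_injective.comp r.injective)
      have h := ((Finset.mem_filter.1 (r (x i)).2).2).2 i
      rw [hi, add_self_of_zmod_two] at h
      exact h h0
    let gl : β × A × (A → Fin k → ZMod 2) → (Fin k → ZMod 2) → G :=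
      fun l h => if hh : h ∈ H then e.symm (l.1, ⟨h, hh⟩) else 0
    have hgl : ∀ l (w : ((Fin k → ZMod 2) × G) × A × (A → Fin k → ZMod 2)),
        (w.2 = l.2 ∧ w.1.2 ∈ gl l '' H) ↔ ∃ h : w.1.2 ∉ J, ((e ⟨w.1.2, h⟩).1, w.2) = l := by
      rintro ⟨b, γ'⟩ ⟨⟨a, g⟩, γ⟩
      simp only [mem_image, Finset.mem_coe, Prod.mk.injEq]
      constructor
      · rintro ⟨rfl, h, hh, rfl⟩
        simp only [gl, dif_pos hh]
        exact ⟨(e.symm (b, ⟨h, hh⟩)).2, by simp, trivial⟩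
      · rintro ⟨hg, h₁, h₂⟩
        refine ⟨h₂, (e ⟨g, hg⟩).2, (e ⟨g, hg⟩).2.2, ?_⟩
        simp only [gl, ← h₁]
        simp
    have key := tileable_colour_class_union h0 s (fun l => l.2) gl (by
        intro l _ h hh h' hh' heq
        simp only [gl, dif_pos (Finset.mem_coe.1 hh), dif_pos (Finset.mem_coe.1 hh')] at heq
        simpa using e.symm.injective (Subtype.ext heq)) c (by
        intro l hl h
        have := (Finset.mem_filter.1 hl).2.1
        rw [h, add_self_of_zmod_two] at this
        exact this h0) (by
        intro l _ l' _ hne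
        rw [onFun, Set.disjoint_left]
        intro w h h'
        obtain ⟨_, h⟩ := (hgl l w).1 h
        obtain ⟨_, h'⟩ := (hgl l' w).1 h'
        exact hne (h.symm.trans h')) ((Nat.mul_le_mul_right _ hs).trans hdim)
    convert key.prod_singleton x using 1
    ext ⟨⟨w, x₀⟩, x'⟩
    simp only [mem_inter_iff, mem_ofPred_eq, mem_preimage, mem_singleton_iff, mem_prod,
      Prod.mk.injEq, hgl]
    constructor
    · rintro ⟨h₁, rfl, rfl⟩
      refine ⟨?_, rfl⟩
      by_cases hx : x₀ + colour w.2 ∈ H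
      · simp only [if_pos hx]
        exact Or.inl ⟨trivial, hx⟩
      · obtain ⟨-, hJ, h₂⟩ := h₁.resolve_left hx
        simp only [if_neg hx]
        refine Or.inr ⟨trivial, _, ?_, hJ, rfl⟩
        simp only [s, Finset.mem_filter, Finset.mem_univ, true_and]
        simp only [if_neg hx]
        refine ⟨hx, ?_⟩
        simpa [v', hJ] using h₂
    · rintro ⟨⟨hc, hx⟩ | ⟨rfl, l, hl, hJ, rfl⟩, rfl⟩
      · subst hc
        exact ⟨Or.inl hx, rfl, if_pos hx⟩
      · obtain ⟨h₁, h₂⟩ := (Finset.mem_filter.1 hl).2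
        refine ⟨Or.inr ⟨h₁, hJ, ?_⟩, rfl, if_neg h₁⟩
        simpa [v', hJ] using h₂
  convert hP₁.union ?_ hP₂ using 1
  · ext ⟨⟨w, x₀⟩, x⟩
    simp only [holes, mem_compl_iff, mem_iUnion, mem_ofPred_eq, mem_union, exists_prop]
    by_cases hx : x₀ + colour w.2 ∈ H
    · simp [hx]
    · by_cases hJ : w.1.2 ∈ J
      · simp [hx, hJ, v']
      · simp only [hx, hJ, false_or, not_false_eq_true, true_and]
        constructor
        · intro _
          by_cases h : ∃ i, x i + v' w i ∈ H
          · exact Or.inr h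
          · push Not at h
            exact Or.inl h
        · rintro _ ⟨g, hg, rfl, -⟩
          exact hJ hg
  · rw [Set.disjoint_left]
    rintro y h ⟨h₁, i, h₂⟩
    exact (h.resolve_left h₁).2.2 i h₂

theorem tileable_compl_holes [Finite A] [Fintype G] (h0 : 0 ∈ H)
    (hdim : 2 ^ k * (1 + absorbDim H) ≤ finrank (ZMod 2) A)
    (J : Finset G) (hJ : J.card ≡ Fintype.card G [MOD H.card]) :
    Tileable (affTiles H (((((Fin k → ZMod 2) × G) × A × (A → Fin k → ZMod 2)) ×
      (Fin k → ZMod 2)) ×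
      (((Fin k → ZMod 2) → Fin (Fintype.card G) × A × (A → Fin k → ZMod 2)) → Fin k → ZMod 2)))
      (⋃ g ∈ J, holes H A _ g)ᶜ := by
  classical
  have := Fintype.ofFinite A
  obtain ⟨n, hn⟩ := (Nat.modEq_iff_dvd' (Finset.card_le_univ J)).1 hJ
  have hpos : 0 < H.card := Finset.card_pos.2 ⟨0, h0⟩
  have hn' : n ≤ Fintype.card G := by
    calc n ≤ H.card * n := Nat.le_mul_of_pos_left n hpos
      _ ≤ Fintype.card G := by omega
  have hcard : Fintype.card {g // g ∉ (J : Set G)} = Fintype.card (Fin n × H) := by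
    rw [Fintype.card_prod, Fintype.card_fin, Fintype.card_coe, mul_comm, ← hn]
    simp only [Finset.mem_coe]
    rw [Fintype.card_subtype_compl, Fintype.card_coe]
  -- The number `n` of batches depends on `J`; relabelling inside `Fin (Fintype.card G)` keeps the
  -- ambient space independent of `J`.
  let emb : Fin n × A × (A → Fin k → ZMod 2) →
    Fin (Fintype.card G) × A × (A → Fin k → ZMod 2) := fun l => (Fin.castLE hn' l.1, l.2)
  have hemb : Injective emb := by
    rintro ⟨a, b⟩ ⟨a', b'⟩ h
    simpa [emb] using h
  -- A block is a family of batch labels indexed by vectors, and the shift is a position at which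
  -- the label occurs. An injective family is its own witness.
  let v : Fin n × A × (A → Fin k → ZMod 2) →
    ((Fin k → ZMod 2) → Fin (Fintype.card G) × A × (A → Fin k → ZMod 2)) → Fin k → ZMod 2 :=
    fun l i => if h : ∃ s, i s = emb l then h.choose else 0
  have := tileable_compl_holes_of_batches h0 hdim (J : Set G) (Fintype.equivOfCardEq hcard) v (by
    intro r hr
    refine ⟨emb ∘ r, fun s => ?_⟩
    have h : ∃ s', (emb ∘ r) s' = emb (r s) := ⟨s, rfl⟩
    simp only [v, dif_pos h]
    exact hr (hemb h.choose_spec))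
  simpa using this

end Flex

/-! ### From affine tiles to coordinate tiles; flexible families. -/

section Lift

open Module

variable {k : ℕ} {H : Finset (Fin k → ZMod 2)}

theorem linearCombination_extend {Y : Type*} [AddCommGroup Y] [Module (ZMod 2) Y] [Fintype Y]
    (φ : (Fin k → ZMod 2) →ₗ[ZMod 2] Y) (f : Fin k ↪ Y) (hf : ∀ j, f j = φ (Pi.single j 1))
    (h : Fin k → ZMod 2) :
    Fintype.linearCombination (ZMod 2) (id : Y → Y) (extend f h 0) = φ h := by
  rw [Fintype.linearCombination_apply, LinearMap.pi_apply_eq_sum_univ φ h]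
  symm
  refine Fintype.sum_of_injective f f.injective _ _ (fun i hi => ?_) fun j => ?_
  · rw [extend_apply' _ _ _ hi]
    simp
  · rw [f.injective.extend_apply, id, hf]
    congr 2
    ext i
    simp [Pi.single_apply, eq_comm]

/-- The map sends the basis vector e_y to y. The preimage of u + φ(H) is therefore the disjoint
union, over the points z above u, of copies of H at z in the directions φ(e_j); injectivity of φ
makes the directions distinct and the copies disjoint. -/
theorem tileable_preimage_linearCombination {Y : Type*} [AddCommGroup Y] [Module (ZMod 2) Y]
    [Fintype Y] {X : Set Y} (hX : Tileable (affTiles H Y) X) :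
    Tileable (cubeTiles H Y) (Fintype.linearCombination (ZMod 2) (id : Y → Y) ⁻¹' X) := by
  refine hX.preimage ?_
  rintro _ ⟨φ, u, hφ, rfl⟩
  let f : Fin k ↪ Y := ⟨fun j => φ (Pi.single j 1), fun i j hij => by
    by_contra hne
    have := congrFun (hφ hij) i
    simp [hne] at this⟩
  have hσ := linearCombination_extend φ f fun _ => rfl
  let σ := Fintype.linearCombination (ZMod 2) (id : Y → Y)
  have : σ ⁻¹' ((fun h => u + φ h) '' H) =
      ⋃ z ∈ σ ⁻¹' {u}, (fun h => z + extend f h 0) '' H := by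
    ext y
    simp only [mem_preimage, mem_image, mem_iUnion, mem_singleton_iff, exists_prop]
    constructor
    · rintro ⟨h, hh, hy⟩
      refine ⟨y - extend f h 0, ?_, h, hh, by simp⟩
      rw [map_sub, hσ, ← hy, add_sub_cancel_right]
    · rintro ⟨z, hz, h, hh, rfl⟩
      exact ⟨h, hh, by rw [map_add, hσ, hz]⟩
  rw [this]
  refine Tileable.biUnion ?_ fun z _ => Tileable.of_mem ⟨f, z, rfl⟩
  intro z hz z' hz' hne
  rw [onFun, Set.disjoint_left]
  rintro _ ⟨h, -, rfl⟩ ⟨h', -, heq⟩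
  have h₁ : σ (z' + extend f h' 0) = σ (z + extend f h 0) := congrArg σ heq
  rw [map_add, map_add, hσ, hσ, mem_preimage.1 hz, mem_preimage.1 hz', add_right_inj] at h₁
  rw [hφ h₁] at heq
  exact hne (add_right_cancel heq).symm

/-- There are disjoint sets indexed by `κ` such that the complement of the union of any number of
them in a suitable residue class is tileable. -/
def Flexible (H : Finset (Fin k → ZMod 2)) (ι κ : Type*) : Prop :=
  ∃ (W : κ → Set (ι → ZMod 2)) (ρ : ℕ), Pairwise (Disjoint on W) ∧
    ∀ J : Finset κ, J.card ≡ ρ [MOD H.card] → Tileable (cubeTiles H ι) (⋃ j ∈ J, W j)ᶜ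

theorem Flexible.mono {ι κ κ' : Type*} (h : Flexible H ι κ) (f : κ' ↪ κ) : Flexible H ι κ' := by
  obtain ⟨W, ρ, hd, hW⟩ := h
  refine ⟨W ∘ f, ρ, fun i j hij => hd (f.injective.ne hij), fun J hJ => ?_⟩
  simpa using hW (J.map f) (by simpa using hJ)

theorem Tileable.reindex {ι ι' : Type*} {X : Set (ι → ZMod 2)} (hX : Tileable (cubeTiles H ι) X)
    (e : ι ≃ ι') : Tileable (cubeTiles H ι') ((fun x : ι' → ZMod 2 => x ∘ e) ⁻¹' X) := by
  refine hX.preimage ?_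
  rintro _ ⟨f, b, rfl⟩
  refine Tileable.of_mem ⟨f.trans e.toEmbedding, b ∘ e.symm, ?_⟩
  have key : ∀ h : Fin k → ZMod 2,
      (b ∘ e.symm + extend (f.trans e.toEmbedding) h 0) ∘ e = b + extend f h 0 := by
    intro h
    ext i
    simp only [comp_apply, Pi.add_apply, Equiv.symm_apply_apply, add_right_inj]
    by_cases hi : ∃ j, f j = i
    · obtain ⟨j, rfl⟩ := hi
      rw [f.injective.extend_apply]
      exact (f.trans e.toEmbedding).injective.extend_apply h 0 j
    · rw [extend_apply' _ _ _ hi, extend_apply']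
      · rfl
      · rintro ⟨j, hj⟩
        exact hi ⟨j, e.injective hj⟩
  ext x
  simp only [mem_preimage, mem_image]
  refine exists_congr fun h => and_congr_right fun _ => ?_
  rw [← key]
  exact e.surjective.injective_comp_right.eq_iff

theorem Flexible.reindex {ι ι' κ : Type*} (h : Flexible H ι κ) (e : ι ≃ ι') :
    Flexible H ι' κ := by
  obtain ⟨W, ρ, hd, hW⟩ := h
  refine ⟨fun j => (fun x => x ∘ e) ⁻¹' W j, ρ, fun i j hij => (hd hij).preimage _,
    fun J hJ => ?_⟩
  convert (hW J hJ).reindex e using 1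
  ext x
  simp

theorem exists_flexible (h0 : 0 ∈ H) (K : ℕ) : ∃ N, Flexible H (Fin N) (Fin K) := by
  classical
  let G := Fin K → ZMod 2
  let A := Fin (2 ^ k * (1 + absorbDim H)) → ZMod 2
  let Y := ((((Fin k → ZMod 2) × G) × A × (A → Fin k → ZMod 2)) × (Fin k → ZMod 2)) ×
      (((Fin k → ZMod 2) → Fin (Fintype.card G) × A × (A → Fin k → ZMod 2)) → Fin k → ZMod 2)
  have hY : Flexible H Y G := by
    refine ⟨fun g => Fintype.linearCombination (ZMod 2) (id : Y → Y) ⁻¹' (holes H A _ g),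
      Fintype.card G, ?_, fun J hJ => ?_⟩
    · intro g g' hne
      refine Disjoint.preimage _ ?_
      rw [Set.disjoint_left]
      rintro y ⟨rfl, -⟩ ⟨h, -⟩
      exact hne h
    · have := tileable_compl_holes (A := A) h0 (by simp [A]) J hJ
      simpa only [preimage_compl, preimage_iUnion] using tileable_preimage_linearCombination this
  refine ⟨Fintype.card Y, (hY.reindex (Fintype.equivFin Y)).mono ?_⟩
  exact ⟨fun i => Pi.single i 1, fun i j hij => by
    by_contra hne
    have := congrFun hij i
    simp [hne] at this⟩

end Lift

/-! ### Tiling a product by rows or by columns. -/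

section SumFibers

variable {k : ℕ} {H : Finset (Fin k → ZMod 2)} {ι ι' : Type*}

theorem extend_inl (f : Fin k ↪ ι) (b : ι → ZMod 2) (h : Fin k → ZMod 2) (y : ι' → ZMod 2) :
    Sum.elim (b + extend f h 0) y =
      Sum.elim b y + extend (f.trans Function.Embedding.inl) h 0 := by
  ext (i | i)
  · simp only [Sum.elim_inl, Pi.add_apply, add_right_inj]
    by_cases hi : ∃ j, f j = i
    · obtain ⟨j, rfl⟩ := hi
      rw [f.injective.extend_apply]
      exact ((f.trans Function.Embedding.inl).injective.extend_apply h 0 j).symm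
    · rw [extend_apply' _ _ _ hi, extend_apply']
      · rfl
      · rintro ⟨j, hj⟩
        exact hi ⟨j, Sum.inl_injective hj⟩
  · simp only [Sum.elim_inr, Pi.add_apply, left_eq_add]
    rw [extend_apply']
    · rfl
    · rintro ⟨j, hj⟩
      exact absurd hj (by simp)

theorem extend_inr (f : Fin k ↪ ι') (b : ι' → ZMod 2) (h : Fin k → ZMod 2) (y : ι → ZMod 2) :
    Sum.elim y (b + extend f h 0) =
      Sum.elim y b + extend (f.trans Function.Embedding.inr) h 0 := by
  ext (i | i)
  · simp only [Sum.elim_inl, Pi.add_apply, left_eq_add]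
    rw [extend_apply']
    · rfl
    · rintro ⟨j, hj⟩
      exact absurd hj (by simp)
  · simp only [Sum.elim_inr, Pi.add_apply, add_right_inj]
    by_cases hi : ∃ j, f j = i
    · obtain ⟨j, rfl⟩ := hi
      rw [f.injective.extend_apply]
      exact ((f.trans Function.Embedding.inr).injective.extend_apply h 0 j).symm
    · rw [extend_apply' _ _ _ hi, extend_apply']
      · rfl
      · rintro ⟨j, hj⟩
        exact hi ⟨j, Sum.inr_injective hj⟩

theorem Tileable.of_rows {X : Set (ι ⊕ ι' → ZMod 2)}
    (hX : ∀ y : ι' → ZMod 2, Tileable (cubeTiles H ι) {x | Sum.elim x y ∈ X}) :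
    Tileable (cubeTiles H (ι ⊕ ι')) X := by
  refine Tileable.of_fibers (fun x => x ∘ Sum.inr) fun y => ?_
  convert (hX y).image (f := fun x => Sum.elim x y) (𝒯' := cubeTiles H (ι ⊕ ι')) ?_ ?_ using 1
  · ext x
    constructor
    · rintro ⟨hx, rfl⟩
      exact ⟨x ∘ Sum.inl, by simpa using hx, by simp⟩
    · rintro ⟨x, hx, rfl⟩
      exact ⟨hx, by simp⟩
  · intro x x' h
    simpa using congrArg (· ∘ Sum.inl) h
  · rintro _ ⟨f, b, rfl⟩
    refine ⟨f.trans Function.Embedding.inl, Sum.elim b y, ?_⟩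
    rw [image_image]
    simp only [extend_inl]

theorem Tileable.of_columns {X : Set (ι ⊕ ι' → ZMod 2)}
    (hX : ∀ x : ι → ZMod 2, Tileable (cubeTiles H ι') {y | Sum.elim x y ∈ X}) :
    Tileable (cubeTiles H (ι ⊕ ι')) X := by
  refine Tileable.of_fibers (fun x => x ∘ Sum.inl) fun y => ?_
  convert (hX y).image (f := fun x => Sum.elim y x) (𝒯' := cubeTiles H (ι ⊕ ι')) ?_ ?_ using 1
  · ext x
    constructor
    · rintro ⟨hx, rfl⟩
      exact ⟨x ∘ Sum.inr, by simpa using hx, by simp⟩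
    · rintro ⟨x, hx, rfl⟩
      exact ⟨hx, by simp⟩
  · intro x x' h
    simpa using congrArg (· ∘ Sum.inr) h
  · rintro _ ⟨f, b, rfl⟩
    refine ⟨f.trans Function.Embedding.inr, Sum.elim y b, ?_⟩
    rw [image_image]
    simp only [extend_inr]

end SumFibers

/-! ### Row and column sizes modulo m. -/

section Rows

open Finset

theorem sum_fin_ite_val_lt {R : Type*} [CommRing R] {m n : ℕ} (h : n ≤ m) (x : R) :
    ∑ c : Fin m, (if (c : ℕ) < n then x else 0) = n * x := by
  rw [Fin.sum_univ_eq_sum_range (fun c => if c < n then x else 0) m, ← Finset.sum_filter]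
  have : (range m).filter (· < n) = range n := by
    ext i
    simp only [Finset.mem_filter, Finset.mem_range]
    omega
  rw [this, Finset.sum_const, card_range, nsmul_eq_mul]

theorem sum_fin_ite_val_eq_zero {m : ℕ} (hm : 0 < m) (x y : ZMod m) :
    ∑ e : Fin m, (if (e : ℕ) = 0 then x else y) = x - y := by
  have h : ∀ e : Fin m, (if (e : ℕ) = 0 then x else y) =
      y + if (e : ℕ) < 1 then x - y else 0 := by
    intro e
    by_cases he : (e : ℕ) = 0
    · simp [he]
    · simp [he]
  rw [Finset.sum_congr rfl fun e _ => h e, Finset.sum_add_distrib, sum_fin_ite_val_lt hm]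
  simp

/-- Sets with prescribed sizes modulo `m` of its rows can be completed by dummy rows of size
`0` modulo `m` so that every column has the same size modulo `m`. -/
theorem exists_rows {α : Type*} [Fintype α] {m t : ℕ} (hm : 0 < m) (ht : m + 1 ≤ t) (ρ : ℕ)
    (r : α → ℕ) (hr : ∑ i, r i ≡ t * ρ [MOD m]) :
    ∃ A : α ⊕ Fin t × Fin m × Fin m → Finset (Fin t),
      (∀ i, (A (Sum.inl i)).card ≡ r i [MOD m]) ∧ (∀ d, (A (Sum.inr d)).card ≡ 0 [MOD m]) ∧
      ∀ b, (univ.filter fun r => b ∈ A r).card ≡ ρ [MOD m] := by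
  classical
  have : NeZero m := ⟨hm.ne'⟩
  simp only [← ZMod.natCast_eq_natCast_iff] at hr ⊢
  let a₀ : Fin t := ⟨0, by omega⟩
  have h₁ : ∀ i, ∃ A : Finset (Fin t), A.card = r i % m := fun i => by
    obtain ⟨A, -, hA⟩ := exists_subset_card_eq (s := (univ : Finset (Fin t))) (n := r i % m)
      (by have := Nat.mod_lt (r i) hm; simp; omega)
    exact ⟨A, hA⟩
  choose B hB using h₁
  have h₂ : ∀ a, ∃ A : Finset (Fin t), a ∉ A ∧ a₀ ∉ A ∧ A.card = m - 1 := fun a => by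
    obtain ⟨A, hA, hA'⟩ := exists_subset_card_eq (s := ({a, a₀} : Finset (Fin t))ᶜ) (n := m - 1)
      (by
        rw [card_compl, Fintype.card_fin]
        have := card_le_two (a := a) (b := a₀)
        omega)
    refine ⟨A, fun h => ?_, fun h => ?_, hA'⟩
    · simpa using hA h
    · simpa using hA h
  choose C hC₁ hC₂ hC₃ using h₂
  -- The defect of each column; by `hr` the defects sum to zero.
  let d : Fin t → ZMod m := fun b => ρ - ∑ i, if b ∈ B i then 1 else 0
  have hd : ∑ b, d b = 0 := by
    simp only [d, Finset.sum_sub_distrib]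
    rw [Finset.sum_comm]
    have : ∀ i, ∑ b, (if b ∈ B i then (1 : ZMod m) else 0) = r i := fun i => by
      rw [Finset.sum_ite_mem, Finset.univ_inter, Finset.sum_const, hB, nsmul_eq_mul, mul_one,
        ZMod.natCast_mod]
    rw [Finset.sum_congr rfl fun i _ => this i]
    push_cast at hr
    simp [hr]
  -- A group of m dummy rows shares `C a`, which adds m to those columns; one row also contains `a`
  -- and the other m − 1 contain `a₀`. The net effect modulo m is to move one unit from column `a₀`
  -- to column `a`, and this is done `d a` times.
  let D : Fin t × Fin m × Fin m → Finset (Fin t) := fun x =>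
    if (x.2.1 : ℕ) < (d x.1).val then insert (if (x.2.2 : ℕ) = 0 then x.1 else a₀) (C x.1) else ∅
  refine ⟨Sum.elim B D, fun i => ?_, ?_, fun b => ?_⟩
  · simp [hB]
  · rintro ⟨a, c, e⟩
    simp only [Sum.elim_inr, D]
    split_ifs
    · rw [card_insert_of_notMem (hC₁ a), hC₃, Nat.sub_add_cancel hm]
      simp
    · rw [card_insert_of_notMem (hC₂ a), hC₃, Nat.sub_add_cancel hm]
      simp
    · simp
  · rw [natCast_card_filter, Fintype.sum_sum_type, Fintype.sum_prod_type]
    simp only [Fintype.sum_prod_type]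
    change ∑ i, (if b ∈ B i then (1 : ZMod m) else 0) + ∑ a : Fin t, ∑ c : Fin m, ∑ e : Fin m,
      (if b ∈ D (a, c, e) then (1 : ZMod m) else 0) = ρ
    have h₁ : ∀ (a : Fin t) (c : Fin m), ∑ e : Fin m, (if b ∈ D (a, c, e) then (1 : ZMod m) else 0)
        = if (c : ℕ) < (d a).val then (if b = a then 1 else 0) - (if b = a₀ then 1 else 0)
          else 0 := by
      intro a c
      by_cases hc : (c : ℕ) < (d a).val
      · rw [if_pos hc, ← sum_fin_ite_val_eq_zero hm]
        have : ∀ e : Fin m, (if b ∈ D (a, c, e) then (1 : ZMod m) else 0) =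
            (if b ∈ C a then 1 else 0) + if (e : ℕ) = 0 then (if b = a then 1 else 0) else
              (if b = a₀ then 1 else 0) := by
          intro e
          simp only [D, if_pos hc, Finset.mem_insert]
          have h₁ : b = a → b ∉ C a := fun h => h ▸ hC₁ a
          have h₂ : b = a₀ → b ∉ C a := fun h => h ▸ hC₂ a
          by_cases he : (e : ℕ) = 0
          · by_cases hb : b = a
            · simp [he, hb, hC₁]
            · simp [he, hb]
          · by_cases hb : b = a₀
            · simp [he, hb, hC₂]
            · simp [he, hb]
        rw [Finset.sum_congr rfl fun e _ => this e, Finset.sum_add_distrib]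
        simp
      · simp [D, hc]
    have h₂ : ∀ a : Fin t, ∑ c : Fin m, ∑ e : Fin m,
        (if b ∈ D (a, c, e) then (1 : ZMod m) else 0)
        = d a * ((if b = a then 1 else 0) - (if b = a₀ then 1 else 0)) := by
      intro a
      rw [Finset.sum_congr rfl fun c _ => h₁ a c, sum_fin_ite_val_lt (ZMod.val_lt _).le]
      simp
    rw [Finset.sum_congr rfl fun a _ => h₂ a]
    simp only [mul_sub, Finset.sum_sub_distrib, ← Finset.sum_mul, hd]
    simp [d]

end Rows

/-! ### Multiplying the number of flexible sets. -/

section Amplify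

variable {k : ℕ} {H : Finset (Fin k → ZMod 2)}

/-- The new sets are products W₁ i × W₂ j. The `t` auxiliary sets of the second family correct
residues: over the `a`-th one, tile the complement of the W₁ r with `a ∈ A r`, which the column
condition of `exists_rows` permits. The row condition then makes every remaining fibre in the other
direction tileable. -/
theorem Flexible.prod {t : ℕ} {ι ι' α κ : Type*} [Fintype α] [Fintype κ] (hH : 0 < H.card)
    {W₂ : κ ⊕ Fin t → Set (ι' → ZMod 2)} {ρ₂ : ℕ} (hd₂ : Pairwise (Disjoint on W₂))
    (hW₂ : ∀ J : Finset (κ ⊕ Fin t), J.card ≡ ρ₂ [MOD H.card] →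
      Tileable (cubeTiles H ι') (⋃ j ∈ J, W₂ j)ᶜ)
    (ht : H.card + 1 ≤ t) (htρ : t ≡ ρ₂ [MOD H.card])
    (h₁ : Flexible H ι (α ⊕ Fin t × Fin H.card × Fin H.card)) :
    Flexible H (ι ⊕ ι') (α × κ) := by
  classical
  obtain ⟨W₁, ρ₁, hd₁, hW₁⟩ := h₁
  have huniq₁ : ∀ {i j x}, x ∈ W₁ i → x ∈ W₁ j → i = j := fun {i j x} hi hj => by
    by_contra hne
    exact Set.disjoint_left.1 (hd₁ hne) hi hj
  have huniq₂ : ∀ {i j x}, x ∈ W₂ i → x ∈ W₂ j → i = j := fun {i j x} hi hj => by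
    by_contra hne
    exact Set.disjoint_left.1 (hd₂ hne) hi hj
  refine ⟨fun p => {x | x ∘ Sum.inl ∈ W₁ (Sum.inl p.1) ∧ x ∘ Sum.inr ∈ W₂ (Sum.inl p.2)}, t * ρ₁,
    ?_, fun J hJ => ?_⟩
  · rintro ⟨i, j⟩ ⟨i', j'⟩ hne
    rw [onFun, Set.disjoint_left]
    rintro x ⟨h₁, h₂⟩ ⟨h₁', h₂'⟩
    refine hne (Prod.ext ?_ ?_)
    · simpa using huniq₁ h₁ h₁'
    · simpa using huniq₂ h₂ h₂'
  obtain ⟨A, hA₁, hA₂, hA₃⟩ := exists_rows hH ht ρ₁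
    (fun i => (Finset.univ.filter fun j => (i, j) ∈ J).card) (by
      convert hJ using 1
      simp only [Finset.card_filter]
      rw [← Fintype.sum_prod_type']
      simp)
  let X : Set (ι ⊕ ι' → ZMod 2) :=
    {x | ∃ a, x ∘ Sum.inr ∈ W₂ (Sum.inr a) ∧ ∀ r, a ∈ A r → x ∘ Sum.inl ∉ W₁ r}
  have hX : Tileable (cubeTiles H (ι ⊕ ι')) X := by
    refine Tileable.of_rows fun y => ?_
    by_cases hy : ∃ a, y ∈ W₂ (Sum.inr a)
    · obtain ⟨a, ha⟩ := hy
      convert hW₁ _ (hA₃ a) using 1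
      ext x
      simp only [X, mem_ofPred_eq, Sum.elim_comp_inr, Sum.elim_comp_inl, Finset.mem_filter,
        Finset.mem_univ, true_and, mem_compl_iff, mem_iUnion, exists_prop, not_exists, not_and]
      constructor
      · rintro ⟨a', ha', h⟩
        obtain rfl : a = a' := by simpa using huniq₂ ha ha'
        exact h
      · exact fun h => ⟨a, ha, h⟩
    · convert Tileable.empty using 1
      rw [eq_empty_iff_forall_notMem]
      rintro x ⟨a, ha, -⟩
      exact hy ⟨a, by simpa using ha⟩
  let X' : Set (ι ⊕ ι' → ZMod 2) :=
    {x | (∀ i j, (i, j) ∈ J → x ∘ Sum.inl ∈ W₁ (Sum.inl i) → x ∘ Sum.inr ∉ W₂ (Sum.inl j)) ∧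
      ∀ a, x ∘ Sum.inr ∈ W₂ (Sum.inr a) → ∃ r, a ∈ A r ∧ x ∘ Sum.inl ∈ W₁ r}
  have hX' : Tileable (cubeTiles H (ι ⊕ ι')) X' := by
    refine Tileable.of_columns fun x => ?_
    let K₁ : Finset κ := Finset.univ.filter fun j => ∃ i, (i, j) ∈ J ∧ x ∈ W₁ (Sum.inl i)
    let K₂ : Finset (Fin t) := Finset.univ.filter fun a => ∀ r, x ∈ W₁ r → a ∉ A r
    have hK : (K₁.disjSum K₂).card ≡ ρ₂ [MOD H.card] := by
      rw [Finset.card_disjSum]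
      refine Nat.ModEq.trans ?_ htρ
      -- If x lies in W₁ r, then K₁ has |A r| elements modulo m and K₂ is the complement of A r;
      -- otherwise K₁ is empty and K₂ is everything. Either way the total is t modulo m.
      by_cases hx : ∃ r, x ∈ W₁ r
      · obtain ⟨r, hr⟩ := hx
        have hK₂ : K₂ = (A r)ᶜ := by
          ext a
          simp only [K₂, Finset.mem_filter, Finset.mem_univ, true_and, Finset.mem_compl]
          exact ⟨fun h => h r hr, fun h r' hr' => huniq₁ hr hr' ▸ h⟩
        have hK₁ : (A r).card ≡ K₁.card [MOD H.card] := by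
          rcases r with i | d
          · have : K₁ = Finset.univ.filter fun j => (i, j) ∈ J := by
              ext j
              simp only [K₁, Finset.mem_filter, Finset.mem_univ, true_and]
              constructor
              · rintro ⟨i', h, hi'⟩
                obtain rfl : i = i' := by simpa using huniq₁ hr hi'
                exact h
              · exact fun h => ⟨i, h, hr⟩
            rw [this]
            exact hA₁ i
          · have : K₁ = ∅ := by
              ext j
              simp only [K₁, Finset.mem_filter, Finset.mem_univ, true_and, Finset.notMem_empty,
                iff_false]
              rintro ⟨i', h, hi'⟩
              simpa using huniq₁ hr hi'
            rw [this]
            exact hA₂ d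
        rw [hK₂]
        refine (hK₁.symm.add_right _).trans ?_
        rw [Finset.card_add_card_compl, Fintype.card_fin]
      · push Not at hx
        have h₁ : K₁ = ∅ := by
          ext j
          simp [K₁, hx]
        have h₂ : K₂ = Finset.univ := by
          ext j
          simp [K₂, hx]
        rw [h₁, h₂]
        simp [Nat.ModEq.refl]
    convert hW₂ _ hK using 1
    ext y
    simp only [X', K₁, K₂, mem_ofPred_eq, Sum.elim_comp_inr, Sum.elim_comp_inl, mem_compl_iff,
      mem_iUnion, exists_prop, not_exists, not_and, Finset.mem_disjSum, Finset.mem_filter,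
      Finset.mem_univ, true_and]
    constructor
    · rintro ⟨h₁, h₂⟩ _ (⟨j, ⟨i, hJ, hi⟩, rfl⟩ | ⟨a, ha, rfl⟩) hy
      · exact h₁ i j hJ hi hy
      · obtain ⟨r, hr, hr'⟩ := h₂ a hy
        exact ha r hr' hr
    · intro h
      refine ⟨fun i j hij hx => h _ (Or.inl ⟨j, ⟨i, hij, hx⟩, rfl⟩), fun a ha => ?_⟩
      by_contra! hcon
      exact h _ (Or.inr ⟨a, fun r hr hr' => hcon r hr' hr, rfl⟩) ha
  convert hX.union ?_ hX' using 1
  · ext x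
    simp only [X, X', mem_ofPred_eq, mem_compl_iff, mem_iUnion, exists_prop, not_exists, not_and,
      mem_union, Prod.forall]
    constructor
    · intro h
      by_cases hx : ∃ a, x ∘ Sum.inr ∈ W₂ (Sum.inr a) ∧ ∀ r, a ∈ A r → x ∘ Sum.inl ∉ W₁ r
      · exact Or.inl hx
      · push Not at hx
        exact Or.inr ⟨h, hx⟩
    · rintro (⟨a, ha, -⟩ | ⟨h, -⟩) i j hij hi hj
      · simpa using huniq₂ ha hj
      · exact h i j hij hi hj
  · rw [Set.disjoint_left]
    rintro x ⟨a, ha, h⟩ ⟨-, h'⟩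
    obtain ⟨r, hr, hr'⟩ := h' a ha
    exact h r hr hr'

theorem exists_modEq_between {m : ℕ} (hm : 0 < m) (ρ : ℕ) :
    ∃ t, t ≡ ρ [MOD m] ∧ m + 1 ≤ t ∧ t ≤ 2 * m := by
  by_cases h : ρ % m = 0
  · refine ⟨2 * m, ?_, by omega, le_rfl⟩
    simp [Nat.ModEq, h]
  · refine ⟨ρ % m + m, ?_, by omega, by have := Nat.mod_lt ρ hm; omega⟩
    simp [Nat.ModEq]

/-- Exponentially many sets are available in cubes of linearly growing dimension. -/
theorem exists_flexible_two_pow (h0 : 0 ∈ H) :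
    ∃ N, ∀ j : ℕ, Flexible H (Fin (N * (j + 1))) (Fin (2 ^ j)) := by
  have hH : 0 < H.card := Finset.card_pos.2 ⟨0, h0⟩
  -- Enough for the base case and for the 2 + t m² sets that each doubling needs, where t ≤ 2m.
  -- Carrying 4m surplus sets survives doubling, as 2(2^j + 4m − t) ≥ 2^(j+1) + 4m.
  obtain ⟨N, hN⟩ := exists_flexible h0 (3 + 2 * H.card * (H.card * H.card) + 4 * H.card)
  refine ⟨N, fun j => ?_⟩
  suffices h : Flexible H (Fin (N * (j + 1))) (Fin (2 ^ j + 4 * H.card)) from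
    h.mono (Fin.castLEEmb (by omega))
  induction j with
  | zero =>
    rw [zero_add, mul_one, pow_zero]
    exact hN.mono (Fin.castLEEmb (by omega))
  | succ j ih =>
    obtain ⟨W, ρ, hd, hW⟩ := ih
    obtain ⟨t, htρ, ht, ht'⟩ := exists_modEq_between hH ρ
    have hpos : 0 < 2 ^ j := by positivity
    let e : Fin (2 ^ j + 4 * H.card - t) ⊕ Fin t ≃ Fin (2 ^ j + 4 * H.card) :=
      finSumFinEquiv.trans (finCongr (by omega))
    have h := Flexible.prod (H := H) (ι := Fin N) (α := Fin 2) (t := t) hH (W₂ := W ∘ e)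
      (ρ₂ := ρ) (fun a b hab => hd (e.injective.ne hab)) (fun J hJ => by
        simpa [-Finset.mem_map_equiv, -Sum.exists] using
          hW (J.map e.toEmbedding) (by simpa using hJ)) ht htρ (by
        refine hN.mono (Function.Embedding.nonempty_of_card_le ?_).some
        simp only [Fintype.card_sum, Fintype.card_prod, Fintype.card_fin]
        have := Nat.mul_le_mul_right (H.card * H.card) ht'
        omega)
    refine (h.mono (κ' := Fin (2 ^ (j + 1) + 4 * H.card))
      (Function.Embedding.nonempty_of_card_le ?_).some).reindex
      (finSumFinEquiv.trans (finCongr (by ring)))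
    simp only [Fintype.card_prod, Fintype.card_fin, pow_succ]
    omega

end Amplify

/-! ### Weighted copies covering heavy points uniformly modulo m. -/

section Lattice

variable {k : ℕ} {H : Finset (Fin k → ZMod 2)} {α : Type*} [Fintype α]

/-- The number of nonzero entries among the coordinates in `α`. -/
def weight {β : Type*} (x : α ⊕ β → ZMod 2) : ℕ :=
  (Finset.univ.filter fun a : α => x (Sum.inl a) ≠ 0).card

theorem sum_sign_eq_zero {R M : Type*} [CommRing R] [AddCommGroup M] [Module R M] (j : Fin k)
    (g : (Fin k → Bool) → M) (hg : ∀ s c, g (update s j c) = g s) :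
    ∑ s : Fin k → Bool, (∏ i, if s i then (-1 : R) else 1) • g s = 0 := by
  refine Finset.sum_involution (fun s _ => update s j (!s j)) (fun s _ => ?_) (fun s _ _ h => ?_)
    (fun _ _ => Finset.mem_univ _) fun s _ => ?_
  · rw [hg, ← add_smul]
    convert zero_smul R _
    have h : ∀ s : Fin k → Bool, (∏ i, if s i then (-1 : R) else 1) =
        (if s j then (-1 : R) else 1) * ∏ i ∈ Finset.univ.erase j, if s i then (-1 : R) else 1 :=
      fun s => (Finset.mul_prod_erase _ _ (Finset.mem_univ j)).symm
    rw [h s, h (update s j _), update_self]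
    have h' : ∏ i ∈ Finset.univ.erase j, (if update s j (!s j) i then (-1 : R) else 1) =
        ∏ i ∈ Finset.univ.erase j, if s i then (-1 : R) else 1 :=
      Finset.prod_congr rfl fun i hi => by rw [update_of_ne (Finset.ne_of_mem_erase hi)]
    rw [h', ← add_mul]
    cases s j <;> simp
  · have := congrFun h j
    simp at this
  · ext i
    by_cases hi : i = j
    · subst hi; simp
    · simp [hi]

/-- The functions which off the points of weight less than `k` are combinations of indicator
functions of copies of `H`. -/
def tileSpan (H : Finset (Fin k → ZMod 2)) (α R : Type*) [Fintype α] [CommRing R] :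
    Submodule R ((α ⊕ Fin k → ZMod 2) → R) where
  carrier := {F | ∃ c : (Fin k ↪ α ⊕ Fin k) → (α ⊕ Fin k → ZMod 2) → R,
    ∀ x, k ≤ weight x → ∑ᶠ f, ∑ h ∈ H, c f (x + extend f h 0) = F x}
  zero_mem' := ⟨0, by simp⟩
  add_mem' := by
    rintro F F' ⟨c, hc⟩ ⟨c', hc'⟩
    refine ⟨c + c', fun x hx => ?_⟩
    rw [Pi.add_apply, ← hc x hx, ← hc' x hx, ← finsum_add_distrib (toFinite _) (toFinite _)]
    simp [Finset.sum_add_distrib]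
  smul_mem' := by
    rintro r F ⟨c, hc⟩
    refine ⟨r • c, fun x hx => ?_⟩
    rw [Pi.smul_apply, ← hc x hx, smul_finsum' _ (toFinite _)]
    simp [Finset.mul_sum]

theorem sum_single_mem_tileSpan [DecidableEq α] (R : Type*) [CommRing R] (f : Fin k ↪ α ⊕ Fin k)
    (b : α ⊕ Fin k → ZMod 2) :
    ∑ h ∈ H, Pi.single (b + extend f h 0) 1 ∈ tileSpan H α R := by
  classical
  refine ⟨Pi.single f (Pi.single b 1), fun x _ => ?_⟩
  rw [finsum_eq_single _ f (fun f' hf' => by simp [hf']), Finset.sum_apply, Pi.single_eq_same]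
  refine Finset.sum_congr rfl fun h _ => ?_
  have : x + extend f h 0 = b ↔ x = b + extend f h 0 := by
    constructor
    · rintro rfl
      rw [add_assoc, add_self_of_zmod_two, add_zero]
    · rintro rfl
      rw [add_assoc, add_self_of_zmod_two, add_zero]
  simp only [Pi.single_apply, this]

/-- Choose k nonzero coordinates of x in `α`, pair them with the k spare ones, and take the
alternating sum of the copies of H over all ways of choosing one direction from each pair. Only the
points with h = 0 survive: x itself and points in which some chosen one has moved to a spare
coordinate. The latter have smaller weight, so induction applies. -/
theorem single_mem_tileSpan [DecidableEq α] (h0 : 0 ∈ H) (R : Type*) [CommRing R]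
    (x : α ⊕ Fin k → ZMod 2) : Pi.single x 1 ∈ tileSpan H α R := by
  induction hn : weight x using Nat.strong_induction_on generalizing x with
  | _ n ih =>
  subst hn
  by_cases hx : k ≤ weight x
  swap
  · refine ⟨0, fun y hy => ?_⟩
    have : y ≠ x := by rintro rfl; exact hx hy
    simp [this]
  obtain ⟨t, ht, htk⟩ := Finset.exists_subset_card_eq hx
  let i : Fin k ↪ α := (t.equivFinOfCardEq htk).symm.toEmbedding.trans (Embedding.subtype _)
  have hi : ∀ j, x (Sum.inl (i j)) = 1 := fun j => by
    have := ht ((t.equivFinOfCardEq htk).symm j).2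
    exact zmod_two_eq_one_of_ne_zero (Finset.mem_filter.1 this).2
  let f : (Fin k → Bool) → Fin k ↪ α ⊕ Fin k := fun s =>
    ⟨fun j => if s j then Sum.inr j else Sum.inl (i j), fun j j' h => by
      dsimp only at h
      split_ifs at h
      · simpa using h
      · simpa using h⟩
  have hf : ∀ s j, f s j = if s j then Sum.inr j else Sum.inl (i j) := fun _ _ => rfl
  let b : α ⊕ Fin k → ZMod 2 := x + extend (f fun _ => false) 1 0
  let ε : (Fin k → Bool) → R := fun s => ∏ i, if s i then (-1 : R) else 1
  -- the points of the copies given by `f s` with a vanishing coordinate cancel out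
  have key : ∑ s, ε s • ∑ h ∈ H, Pi.single (b + extend (f s) (1 + h) 0) (1 : R) =
      ∑ s, ε s • (Pi.single (b + extend (f s) 1 0) 1 : (α ⊕ Fin k → ZMod 2) → R) := by
    simp_rw [Finset.smul_sum]
    rw [Finset.sum_comm, Finset.sum_eq_single_of_mem 0 h0]
    · simp
    · intro h _ hne
      obtain ⟨j, hj⟩ := Function.ne_iff.1 hne
      have hj' : (1 + h) j = 0 := by
        rw [Pi.add_apply, zmod_two_eq_one_of_ne_zero hj]
        exact add_self_of_zmod_two _
      refine sum_sign_eq_zero j (fun s =>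
        (Pi.single (b + extend (f s) (1 + h) 0) 1 : (α ⊕ Fin k → ZMod 2) → R)) ?_
      intro s c
      have hext : ∀ s y, extend (f s) (1 + h) 0 y =
          ∑ l ∈ Finset.univ.erase j, if f s l = y then (1 + h) l else 0 := by
        intro s y
        by_cases hy : ∃ l, f s l = y
        · obtain ⟨l, rfl⟩ := hy
          rw [(f s).injective.extend_apply]
          by_cases hl : l = j
          · rw [hl, hj', Finset.sum_eq_zero]
            intro l' hl'
            rw [if_neg ((f s).injective.ne (Finset.ne_of_mem_erase hl'))]
          · rw [Finset.sum_eq_single_of_mem l (by simp [hl])]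
            · simp
            · intro l' _ hl'
              rw [if_neg ((f s).injective.ne hl')]
        · rw [extend_apply' _ _ _ hy, Finset.sum_eq_zero]
          · rfl
          · intro l _
            rw [if_neg fun h => hy ⟨l, h⟩]
      have : extend (f (update s j c)) (1 + h) 0 = extend (f s) (1 + h) 0 := by
        ext y
        rw [hext, hext]
        refine Finset.sum_congr rfl fun l hl => ?_
        rw [hf, hf, update_of_ne (Finset.ne_of_mem_erase hl)]
      rw [this]
  have hmem : ∑ s, ε s • ∑ h ∈ H, Pi.single (b + extend (f s) (1 + h) 0) (1 : R) ∈
      tileSpan H α R := by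
    refine Submodule.sum_mem _ fun s _ => Submodule.smul_mem _ _ ?_
    have : ∀ h, b + extend (f s) (1 + h) 0 = b + extend (f s) 1 0 + extend (f s) h 0 := by
      intro h
      rw [add_assoc b, add_right_inj]
      ext y
      by_cases hy : ∃ l, f s l = y
      · obtain ⟨l, rfl⟩ := hy
        simp [(f s).injective.extend_apply]
      · simp [extend_apply' _ _ _ hy]
    simp_rw [this]
    exact sum_single_mem_tileSpan R _ _
  rw [key, ← Finset.add_sum_erase _ _ (Finset.mem_univ fun _ => false)] at hmem
  have hfirst : ε (fun _ => false) •
      (Pi.single (b + extend (f fun _ => false) 1 0) 1 : (α ⊕ Fin k → ZMod 2) → R) =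
      Pi.single x 1 := by
    simp only [ε, b, add_assoc, add_self_of_zmod_two]
    simp
  rw [hfirst] at hmem
  refine (Submodule.add_mem_iff_left _ (Submodule.sum_mem _ fun s hs => ?_)).1 hmem
  refine Submodule.smul_mem _ _ (ih _ ?_ _ rfl)
  obtain ⟨j, hj⟩ := Function.ne_iff.1 (Finset.ne_of_mem_erase hs)
  have hj : s j = true := by simpa using hj
  have hval : ∀ a, b (Sum.inl a) + extend (f s) 1 0 (Sum.inl a) ≠ 0 →
      x (Sum.inl a) ≠ 0 ∧ a ≠ i j := by
    intro a ha
    by_cases hai : ∃ l, a = i l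
    · obtain ⟨l, rfl⟩ := hai
      refine ⟨by simp [hi], fun h => ?_⟩
      obtain rfl := i.injective h
      have h₁ : extend (f fun _ => false) 1 0 (Sum.inl (i l)) = (1 : ZMod 2) :=
        (f fun _ => false).injective.extend_apply 1 0 l
      have h₂ : extend (f s) 1 0 (Sum.inl (i l)) = (0 : ZMod 2) := by
        rw [extend_apply']
        · rfl
        · rintro ⟨l', hl'⟩
          rw [hf] at hl'
          split_ifs at hl' with hs'
          · have := i.injective (Sum.inl_injective hl')
            rw [this, hj] at hs'
            exact hs' rfl
      refine ha ?_
      simp only [b, Pi.add_apply, h₁, h₂, hi, add_zero]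
      exact add_self_of_zmod_two _
    · have hext : ∀ s, extend (f s) 1 0 (Sum.inl a) = (0 : ZMod 2) := fun s => by
        rw [extend_apply']
        · rfl
        · rintro ⟨l', hl'⟩
          rw [hf] at hl'
          split_ifs at hl'
          · exact hai ⟨l', (Sum.inl_injective hl').symm⟩
      simp only [b, Pi.add_apply, hext, add_zero] at ha
      exact ⟨ha, fun h => hai ⟨j, h⟩⟩
  refine Finset.card_lt_card (Finset.ssubset_iff_of_subset ?_ |>.2 ⟨i j, ?_, ?_⟩)
  · intro a ha
    exact Finset.mem_filter.2 ⟨Finset.mem_univ _, (hval a (Finset.mem_filter.1 ha).2).1⟩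
  · simp [hi]
  · intro h
    exact (hval _ (Finset.mem_filter.1 h).2).2 rfl

theorem exists_tile_weights (h0 : 0 ∈ H) (α : Type*) [Fintype α] {R : Type*} [CommRing R]
    (ρ : R) :
    ∃ c : (Fin k ↪ α ⊕ Fin k) → (α ⊕ Fin k → ZMod 2) → R,
      ∀ x, k ≤ weight x → ∑ᶠ f, ∑ h ∈ H, c f (x + extend f h 0) = ρ := by
  classical
  suffices h : (fun _ => ρ) ∈ tileSpan H α R from h
  have h : (fun _ => ρ : (α ⊕ Fin k → ZMod 2) → R) = ∑ x, ρ • Pi.single x 1 := by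
    ext x
    simp [Finset.sum_apply, Pi.single_apply]
  rw [h]
  exact Submodule.sum_mem _ fun x _ => Submodule.smul_mem _ _ (single_mem_tileSpan h0 R x)

/-- Such a point is encoded by its spare coordinates and a list of at most k positions, padded with
`none`. -/
theorem card_weight_lt_le (α : Type*) [Fintype α] (k : ℕ) :
    {x : α ⊕ Fin k → ZMod 2 | weight x < k}.ncard ≤ 2 ^ k * (Fintype.card α + 1) ^ k := by
  classical
  let F : (Fin k → ZMod 2) × (Fin k → Option α) → (α ⊕ Fin k → ZMod 2) := fun p =>
    Sum.elim (fun a => if ∃ j, p.2 j = some a then 1 else 0) p.1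
  have hsub : {x : α ⊕ Fin k → ZMod 2 | weight x < k} ⊆ range F := by
    intro x hx
    let t : Finset α := Finset.univ.filter fun a : α => x (Sum.inl a) ≠ 0
    have hcard : Fintype.card t ≤ Fintype.card (Fin k) := by
      rw [Fintype.card_coe, Fintype.card_fin]
      exact (show t.card < k from hx).le
    obtain ⟨e⟩ := Function.Embedding.nonempty_of_card_le hcard
    refine ⟨(x ∘ Sum.inr, fun j => if h : ∃ a, e a = j then some h.choose.1 else none), ?_⟩
    ext (a | a)
    · simp only [F, Sum.elim_inl]
      by_cases ha : x (Sum.inl a) = 0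
      · rw [if_neg, ha]
        rintro ⟨j, hj⟩
        split_ifs at hj with h
        · have h₁ := h.choose.2
          rw [Option.some_inj.1 hj] at h₁
          exact (Finset.mem_filter.1 h₁).2 ha
      · rw [zmod_two_eq_one_of_ne_zero ha, if_pos]
        have hat : a ∈ t := Finset.mem_filter.2 ⟨Finset.mem_univ _, ha⟩
        refine ⟨e ⟨a, hat⟩, ?_⟩
        have h : ∃ a', e a' = e ⟨a, hat⟩ := ⟨_, rfl⟩
        rw [dif_pos h, e.injective h.choose_spec]
    · rfl
  calc _ ≤ (range F).ncard := ncard_le_ncard hsub (toFinite _)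
    _ ≤ (univ : Set ((Fin k → ZMod 2) × (Fin k → Option α))).ncard := by
      rw [← image_univ]
      exact ncard_image_le
    _ = _ := by
      rw [ncard_univ, Nat.card_eq_fintype_card]
      simp

end Lattice

/-! ### Covering all heavy points, and the polynomial bound. -/

section Combine

variable {k : ℕ} {H : Finset (Fin k → ZMod 2)}

/-- The copies of `H` with directions `f` and a corner at `v` in these directions tile every set
which is a union of them. -/
theorem tileable_direction {ι : Type*} (f : Fin k ↪ ι) (v : Fin k → ZMod 2)
    (p : (ι → ZMod 2) → Prop) :
    Tileable (cubeTiles H ι)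
      {x | x ∘ f + v ∈ H ∧ p (x + extend f (x ∘ f + v) 0)} := by
  refine Tileable.of_fibers (fun x => x + extend f (x ∘ f + v) 0) fun b => ?_
  have hres : ∀ h : Fin k → ZMod 2, extend f h 0 ∘ f = h := fun h => by
    ext j
    exact f.injective.extend_apply h 0 j
  have hadd : ∀ (x : ι → ZMod 2) (g : Fin k → ZMod 2), (x + extend f g 0) ∘ f = x ∘ f + g := by
    intro x g
    ext j
    exact congrArg (x (f j) + ·) (f.injective.extend_apply g 0 j)
  by_cases hb : b ∘ f = v ∧ p b
  · refine Tileable.of_mem ⟨f, b, ?_⟩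
    ext x
    simp only [mem_inter_iff, mem_ofPred_eq, mem_preimage, mem_singleton_iff, mem_image,
      Finset.mem_coe]
    constructor
    · rintro ⟨⟨h₁, -⟩, rfl⟩
      exact ⟨_, h₁, by rw [add_assoc, add_self_of_zmod_two, add_zero]⟩
    · rintro ⟨h, hh, rfl⟩
      have h₁ : (b + extend f h 0) ∘ f + v = h := by
        rw [hadd, hb.1, add_right_comm, add_self_of_zmod_two, zero_add]
      have h₂ : b + extend f h 0 + extend f h 0 = b := by
        rw [add_assoc, add_self_of_zmod_two, add_zero]
      rw [h₁, h₂]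
      exact ⟨⟨hh, hb.2⟩, rfl⟩
  · convert Tileable.empty using 1
    rw [eq_empty_iff_forall_notMem]
    rintro x ⟨⟨-, hp⟩, rfl⟩
    refine hb ⟨?_, hp⟩
    rw [hadd, ← add_assoc, add_self_of_zmod_two, zero_add]

theorem exists_tileable_superset {α ι' : Type*} [Fintype α] (h0 : 0 ∈ H)
    (hF : Flexible H ι' ((Fin k ↪ α ⊕ Fin k) × (Fin k → ZMod 2) × Fin H.card)) :
    ∃ X, Tileable (cubeTiles H ((α ⊕ Fin k) ⊕ ι')) X ∧
      {x | k ≤ weight (x ∘ Sum.inl)} ⊆ X := by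
  classical
  have : NeZero H.card := ⟨(Finset.card_pos.2 ⟨0, h0⟩).ne'⟩
  obtain ⟨W, ρ, hd, hW⟩ := hF
  have huniq : ∀ {i j x}, x ∈ W i → x ∈ W j → i = j := fun {i j x} hi hj => by
    by_contra hne
    exact Set.disjoint_left.1 (hd hne) hi hj
  obtain ⟨c, hc⟩ := exists_tile_weights h0 α (ρ : ZMod H.card)
  -- A family is given by directions, by the corner's coordinates in these directions (fixing them
  -- makes the copies disjoint), and by a counter that realises the weight of a corner as a
  -- multiplicity.
  let p : (Fin k ↪ α ⊕ Fin k) × (Fin k → ZMod 2) × Fin H.card → (α ⊕ Fin k → ZMod 2) → Prop :=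
    fun i x => x ∘ i.1 + i.2.1 ∈ H ∧
      (i.2.2 : ℕ) < (c i.1 (x + extend i.1 (x ∘ i.1 + i.2.1) 0)).val
  have hp : ∀ x, k ≤ weight x → (Finset.univ.filter (p · x)).card ≡ ρ [MOD H.card] := by
    intro x hx
    rw [← ZMod.natCast_eq_natCast_iff, Finset.natCast_card_filter, Fintype.sum_prod_type, ← hc x hx,
      finsum_eq_sum_of_fintype]
    refine Finset.sum_congr rfl fun f _ => ?_
    rw [Fintype.sum_prod_type]
    calc _ = ∑ v, if x ∘ f + v ∈ H then c f (x + extend f (x ∘ f + v) 0) else 0 := by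
          refine Finset.sum_congr rfl fun v _ => ?_
          by_cases hv : x ∘ f + v ∈ H
          · simp only [p, hv, true_and, if_true]
            rw [sum_fin_ite_val_lt (ZMod.val_lt _).le]
            simp
          · simp [p, hv]
      _ = ∑ h, if h ∈ H then c f (x + extend f h 0) else 0 :=
          Equiv.sum_comp (Equiv.addLeft (x ∘ f)) fun h =>
            if h ∈ H then c f (x + extend f h 0) else 0
      _ = _ := by rw [Finset.sum_ite_mem, Finset.univ_inter]
  let X₁ : Set ((α ⊕ Fin k) ⊕ ι' → ZMod 2) := {x | ∃ i, p i (x ∘ Sum.inl) ∧ x ∘ Sum.inr ∈ W i}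
  have hX₁ : Tileable (cubeTiles H ((α ⊕ Fin k) ⊕ ι')) X₁ := by
    refine Tileable.of_rows fun y => ?_
    by_cases hy : ∃ i, y ∈ W i
    · obtain ⟨i, hi⟩ := hy
      convert tileable_direction (H := H) i.1 i.2.1 fun b => (i.2.2 : ℕ) < (c i.1 b).val using 1
      ext x
      simp only [X₁, mem_ofPred_eq, Sum.elim_comp_inl, Sum.elim_comp_inr]
      constructor
      · rintro ⟨i', h, hi'⟩
        obtain rfl := huniq hi hi'
        exact h
      · exact fun h => ⟨i, h, hi⟩
    · convert Tileable.empty using 1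
      rw [eq_empty_iff_forall_notMem]
      rintro x ⟨i, -, hi⟩
      exact hy ⟨i, by simpa using hi⟩
  let X₂ : Set ((α ⊕ Fin k) ⊕ ι' → ZMod 2) :=
    {x | k ≤ weight (x ∘ Sum.inl) ∧ ∀ i, p i (x ∘ Sum.inl) → x ∘ Sum.inr ∉ W i}
  have hX₂ : Tileable (cubeTiles H ((α ⊕ Fin k) ⊕ ι')) X₂ := by
    refine Tileable.of_columns fun x => ?_
    by_cases hx : k ≤ weight x
    · convert hW _ (hp x hx) using 1
      ext y
      simp [X₂, hx]
    · convert Tileable.empty using 1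
      rw [eq_empty_iff_forall_notMem]
      rintro y ⟨h, -⟩
      exact hx (by simpa using h)
  refine ⟨X₁ ∪ X₂, hX₁.union ?_ hX₂, fun x hx => ?_⟩
  · rw [Set.disjoint_left]
    rintro x ⟨i, hi, hi'⟩ ⟨-, h⟩
    exact h i hi hi'
  · by_cases h : ∃ i, p i (x ∘ Sum.inl) ∧ x ∘ Sum.inr ∈ W i
    · exact Or.inl h
    · push Not at h
      exact Or.inr ⟨hx, h⟩

theorem exists_tileable_small_compl {a N : ℕ} (h0 : 0 ∈ H)
    (hF : Flexible H (Fin N) ((Fin k ↪ Fin a ⊕ Fin k) × (Fin k → ZMod 2) × Fin H.card)) :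
    ∃ X, Tileable (cubeTiles H (Fin (a + k + N))) X ∧
      Xᶜ.ncard ≤ 2 ^ k * (a + 1) ^ k * 2 ^ N := by
  obtain ⟨X, hX, hsub⟩ := exists_tileable_superset h0 hF
  let e : (Fin a ⊕ Fin k) ⊕ Fin N ≃ Fin (a + k + N) :=
    (Equiv.sumCongr finSumFinEquiv (Equiv.refl _)).trans finSumFinEquiv
  refine ⟨_, hX.reindex e, ?_⟩
  let F : (Fin (a + k + N) → ZMod 2) → (Fin a ⊕ Fin k → ZMod 2) × (Fin N → ZMod 2) :=
    fun x => (x ∘ e ∘ Sum.inl, x ∘ e ∘ Sum.inr)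
  have hF : Injective F := by
    intro x y h
    have h₁ := congrArg Prod.fst h
    have h₂ := congrArg Prod.snd h
    refine e.surjective.injective_comp_right ?_
    ext (i | i)
    · exact congrFun h₁ i
    · exact congrFun h₂ i
  calc _ = (F '' ((fun x => x ∘ e) ⁻¹' X)ᶜ).ncard := (ncard_image_of_injective _ hF).symm
    _ ≤ ({x : Fin a ⊕ Fin k → ZMod 2 | weight x < k} ×ˢ univ).ncard := by
      refine ncard_le_ncard ?_ (toFinite _)
      rintro _ ⟨x, hx, rfl⟩
      refine ⟨?_, mem_univ _⟩
      by_contra hlt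
      exact hx (hsub (show k ≤ weight (x ∘ e ∘ Sum.inl) from not_lt.1 hlt))
    _ ≤ _ := by
      rw [ncard_prod, ncard_univ, Nat.card_eq_fintype_card]
      refine Nat.mul_le_mul ?_ (by simp)
      simpa using card_weight_lt_le (Fin a) k

theorem exists_polynomial_tileable (h0 : 0 ∈ H) :
    ∃ c C : ℕ, ∀ n : ℕ, 1 ≤ n → ∃ X, Tileable (cubeTiles H (Fin n)) X ∧ Xᶜ.ncard ≤ C * n ^ c := by
  obtain ⟨N₀, hN₀⟩ := exists_flexible_two_pow h0
  refine ⟨k + N₀ * k, 2 ^ k * (2 ^ (k + N₀ * k) * 2 ^ (N₀ * (k + H.card + 1))), fun n hn => ?_⟩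
  obtain ⟨L, hL, hL'⟩ : ∃ L, n ≤ 2 ^ L ∧ 2 ^ L ≤ 2 * n := by
    refine ⟨Nat.log 2 n + 1, (Nat.lt_pow_succ_log_self one_lt_two n).le, ?_⟩
    rw [pow_succ, mul_comm]
    exact Nat.mul_le_mul_left 2 (Nat.pow_log_le_self 2 (by omega))
  -- The families number at most (a + k)^k · 2^k · m ≤ 2^(Lk + k + m), so this dimension suffices;
  -- it is O(log n), hence 2^N is polynomial in n.
  let N := N₀ * (L * k + k + H.card + 1)
  have hN : 2 ^ k * (2 * n) ^ k * 2 ^ N ≤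
      2 ^ k * (2 ^ (k + N₀ * k) * 2 ^ (N₀ * (k + H.card + 1))) * n ^ (k + N₀ * k) := by
    have h : 2 ^ N ≤ (2 * n) ^ (N₀ * k) * 2 ^ (N₀ * (k + H.card + 1)) := by
      calc 2 ^ N = (2 ^ L) ^ (N₀ * k) * 2 ^ (N₀ * (k + H.card + 1)) := by
            rw [← pow_mul, ← pow_add]
            congr 1
            ring
        _ ≤ _ := Nat.mul_le_mul_right _ (Nat.pow_le_pow_left hL' _)
    calc _ ≤ 2 ^ k * (2 * n) ^ k * ((2 * n) ^ (N₀ * k) * 2 ^ (N₀ * (k + H.card + 1))) :=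
          Nat.mul_le_mul_left _ h
      _ = 2 ^ k * ((2 * n) ^ (k + N₀ * k) * 2 ^ (N₀ * (k + H.card + 1))) := by
          rw [pow_add (2 * n)]
          ring
      _ = _ := by
          rw [mul_pow]
          ring
  by_cases hlarge : k + N ≤ n
  · obtain ⟨a, ha⟩ : ∃ a, n = a + k + N := ⟨n - (k + N), by omega⟩
    have hF : Flexible H (Fin N) ((Fin k ↪ Fin a ⊕ Fin k) × (Fin k → ZMod 2) × Fin H.card) := by
      refine (hN₀ (L * k + k + H.card)).mono (Function.Embedding.nonempty_of_card_le ?_).some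
      simp only [Fintype.card_prod, Fintype.card_embedding_eq, Fintype.card_sum, Fintype.card_fin,
        Fintype.card_pi, ZMod.card, Finset.prod_const, Finset.card_univ]
      rw [pow_add, pow_add, mul_assoc]
      refine Nat.mul_le_mul ?_ (Nat.mul_le_mul_left _ Nat.lt_two_pow_self.le)
      calc _ ≤ (a + k) ^ k := Nat.descFactorial_le_pow _ _
        _ ≤ (2 ^ L) ^ k := Nat.pow_le_pow_left (by omega) _
        _ = _ := (pow_mul _ _ _).symm
    obtain ⟨X, hX, hcard⟩ := exists_tileable_small_compl h0 hF
    subst ha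
    refine ⟨X, hX, hcard.trans (le_trans ?_ hN)⟩
    gcongr
    omega
  -- If n < k + N, the whole cube is already within the bound.
  · refine ⟨∅, Tileable.empty, ?_⟩
    calc _ ≤ 2 ^ n := by
          rw [compl_empty, ncard_univ, Nat.card_eq_fintype_card]
          simp
      _ ≤ 2 ^ (k + N) := Nat.pow_le_pow_right two_pos (by omega)
      _ ≤ 2 ^ k * (2 * n) ^ k * 2 ^ N := by
          rw [pow_add]
          exact Nat.mul_le_mul_right _ (Nat.le_mul_of_pos_right _ (by positivity))
      _ ≤ _ := hN

end Combine

/-! ### Back to induced subgraphs of the hypercube. -/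

section Transfer

variable {k : ℕ} {H : Finset (Fin k → ZMod 2)}

theorem hammingDist_extend {ι : Type*} [Fintype ι] (f : Fin k ↪ ι) (h h' : Fin k → ZMod 2) :
    hammingDist (extend f h 0) (extend f h' 0) = hammingDist h h' := by
  classical
  rw [hammingDist, hammingDist, ← Finset.card_map f]
  congr 1
  ext i
  simp only [Finset.mem_filter, Finset.mem_univ, true_and, Finset.mem_map]
  by_cases hi : ∃ j, f j = i
  · obtain ⟨j, rfl⟩ := hi
    simp [f.injective.extend_apply]
  · rw [extend_apply' _ _ _ hi, extend_apply' _ _ _ hi]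
    simp only [ne_eq, not_true_eq_false, false_iff]
    rintro ⟨j, -, hj⟩
    exact hi ⟨j, hj⟩

theorem hammingDist_add_left {ι : Type*} [Fintype ι] (b x y : ι → ZMod 2) :
    hammingDist (b + x) (b + y) = hammingDist x y :=
  hammingDist_comp (fun i => (b i + ·)) fun i => add_right_injective (b i)

theorem nonempty_iso_induce_range {V W : Type*} {H : SimpleGraph V} {G : SimpleGraph W}
    (F : V → W) (hF : Injective F) (hadj : ∀ v w, G.Adj (F v) (F w) ↔ H.Adj v w) :
    Nonempty (H ≃g G.induce (range F)) :=
  ⟨⟨Equiv.ofInjective F hF, fun {v w} => hadj v w⟩⟩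

end Transfer

theorem exists_finset_of_isIndContained {V : Type*} [Nonempty V] {H : SimpleGraph V} {k : ℕ}
    (h : H.IsIndContained (hypercube k)) :
    ∃ (p : V → Fin k → ZMod 2) (S : Finset (Fin k → ZMod 2)), Injective p ∧ range p = S ∧ 0 ∈ S ∧
      ∀ v w, hammingDist (p v) (p w) = 1 ↔ H.Adj v w := by
  classical
  obtain ⟨φ⟩ := h
  let e : Bool → ZMod 2 := fun b => if b then 1 else 0
  have he : Injective e := by decide
  let v₀ : V := Classical.arbitrary V
  let q : V → Fin k → ZMod 2 := fun v i => e (φ v i)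
  have hq : ∀ v w, hammingDist (q v) (q w) = hammingDist (φ v) (φ w) := fun v w =>
    hammingDist_comp (fun _ => e) fun _ => he
  have hd : ∀ v w, hammingDist (q v₀ + q v) (q v₀ + q w) = hammingDist (φ v) (φ w) := fun v w => by
    rw [hammingDist_add_left, hq]
  -- Translating by the image of one vertex puts 0 into the set without changing distances.
  refine ⟨fun v => q v₀ + q v, (toFinite (range fun v => q v₀ + q v)).toFinset, ?_, by simp, ?_, ?_⟩
  · intro v w hvw
    have := hd v w
    rw [hammingDist_eq_zero.2 hvw] at this
    exact φ.injective (hammingDist_eq_zero.1 this.symm)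
  · simp only [Finite.mem_toFinset]
    exact ⟨v₀, add_self_of_zmod_two _⟩
  · intro v w
    rw [hd]
    exact φ.map_rel_iff

theorem theorem1p1 {V : Type*} [Nonempty V] (H : SimpleGraph V)
    (hH : ∃ k : ℕ, H.IsIndContained (hypercube k)) :
    ∃ c C : ℕ, ∀ n : ℕ, 1 ≤ n →
      ∃ P : Set (Set (Fin n → Bool)), IsInducedPacking H (hypercube n) P ∧
        ((⋃₀ P)ᶜ).ncard ≤ C * n ^ c := by
  obtain ⟨k, hk⟩ := hH
  obtain ⟨p, S, hp, hpS, h0, hadj⟩ := exists_finset_of_isIndContained hk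
  obtain ⟨c, C, h⟩ := exists_polynomial_tileable h0
  refine ⟨c, C, fun n hn => ?_⟩
  obtain ⟨X, ⟨P, hP, hd, rfl⟩, hX⟩ := h n hn
  let e : Bool ≃ ZMod 2 := Fintype.equivOfCardEq (by simp)
  let Φ : (Fin n → ZMod 2) ≃ (Fin n → Bool) := Equiv.arrowCongr (Equiv.refl _) e.symm
  have hΦ : ∀ x y, hammingDist (Φ x) (Φ y) = hammingDist x y := fun x y =>
    hammingDist_comp (fun _ => e.symm) fun _ => e.symm.injective
  refine ⟨image Φ '' P, ⟨?_, ?_⟩, ?_⟩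
  · rintro _ ⟨T, hT, rfl⟩
    obtain ⟨f, b, rfl⟩ := hP hT
    have hdist : ∀ v w, hammingDist (Φ (b + extend f (p v) 0)) (Φ (b + extend f (p w) 0)) =
        hammingDist (p v) (p w) := fun v w => by
      rw [hΦ, hammingDist_add_left, hammingDist_extend]
    rw [← hpS, image_image, ← range_comp]
    refine nonempty_iso_induce_range _ (fun v w hvw => ?_) fun v w => ?_
    · exact hp (hammingDist_eq_zero.1 ((hdist v w).symm.trans (hammingDist_eq_zero.2 hvw)))
    · rw [← hadj, ← hdist]
      rfl
  · rintro _ ⟨A, hA, rfl⟩ _ ⟨B, hB, rfl⟩ hAB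
    exact (disjoint_image_iff Φ.injective).2 (hd hA hB fun h => hAB (h ▸ rfl))
  · rwa [← image_sUnion, ← image_compl_eq Φ.bijective, ncard_image_of_injective _ Φ.injective]
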